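/- Let $X$ be a compact hyperkähler manifold of complex dimension $2n$, i.e. a simply connected compact Kähler manifold such that $H^0(X,\Omega_X^2)$ is spanned by a holomorphic symplectic form $\sigma$, and let $D\subset X$ be a smooth (closed) hypersurface. Let $\mathcal F\subset \mathcal T_D$ be the characteristic foliation of $D$, i.e. the line sub-bundle $\mathcal F=\ker(\sigma|_D\colon \mathcal T_D\to\Omega_D)$ with fibres $\mathcal F_x=\{v\in T_xD\mid \sigma(v,w)=0 \text{ for all } w\in T_xD\}$. A leaf is a maximal connected immersed complex submanifold $L\subset D$ with $\mathcal T_L=\mathcal F|_L$ as subsheaves of $\mathcal T_D|_L$. (i) Let $T\subset X$ be a smooth closed complex submanifold that is Lagrangian, i.e. for every $x\in T$ the subspace $T_xT\subset T_xX$ equals its own orthogonal complement with respect to $\sigma$. If $T\subset D$, then $T$ is covered by leaves, i.e. $T$ is the union of the leaves of $\mathcal F$ that are contained in $T$, and, equivalently, every leaf $L\subset D$ with $L\cap T\neq\emptyset$ is contained in $T$. (ii) Let $Z\subset X$ be a subvariety (closed analytic subset) of pure codimension two that is contained in $D$. If $Z$ is invariant under $\mathcal F$, i.e. $\mathcal F_x\subset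 T_xZ$ for every point $x$ of the smooth locus of $Z$, then $Z$ is coisotropic, i.e. over the smooth locus of $Z$ the kernel of $\sigma|_Z\colon\mathcal T_Z\to\Omega_Z$ has rank $2=\operatorname{codim}(Z\subset X)$. -/

import Mathlib

open Set Filter Topology
open scoped Manifold ContDiff

namespace CharFol

noncomputable section

/-! ### Differential two-forms on a complex manifold

A complex manifold is a charted space over a finite dimensional complex vector space `E` whose
transition maps are complex analytic, `IsManifold 𝓘(ℂ, E) ω X`. -/

section Forms

variable {E : Type*} [NormedAddCommGroup E] [NormedSpace ℂ E]
  {X : Type*} [TopologicalSpace X] [ChartedSpace E X]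

/-- The derivative at `y` of the inverse of the chart `e`, a complex linear map from `E` to the
tangent space of `X` at `e.symm y`. -/
def chartFrame (e : OpenPartialHomeomorph X E) (y : E) :
    E →L[ℂ] TangentSpace 𝓘(ℂ, E) (e.symm y) :=
  mfderiv 𝓘(ℂ, E) 𝓘(ℂ, E) e.symm y

variable (E X) in
/-- Complex linear alternating two-forms on the holomorphic tangent bundle (no regularity). -/
abbrev TwoForm : Type _ := (x : X) → TangentSpace 𝓘(ℂ, E) x [⋀^Fin 2]→L[ℂ] ℂ

variable (E X) in
/-- Real two-forms on the real manifold underlying `X` (no regularity). -/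
abbrev RealTwoForm : Type _ := (x : X) → TangentSpace 𝓘(ℂ, E) x [⋀^Fin 2]→L[ℝ] ℝ

/-- Expression of a two-form in the chart `e`, i.e. its pull-back under `e.symm`. -/
def TwoForm.inChart (σ : TwoForm E X) (e : OpenPartialHomeomorph X E) (y : E) :
    E [⋀^Fin 2]→L[ℂ] ℂ :=
  (σ (e.symm y)).compContinuousLinearMap (chartFrame e y)

/-- Expression of a real two-form in the chart `e`, i.e. its pull-back under `e.symm`. -/
def RealTwoForm.inChart (κ : RealTwoForm E X) (e : OpenPartialHomeomorph X E) (y : E) :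
    E [⋀^Fin 2]→L[ℝ] ℝ :=
  (κ (e.symm y)).compContinuousLinearMap ((chartFrame e y).restrictScalars ℝ)

/-- Holomorphic two-forms, i.e. elements of `H⁰(X, Ω²)`. -/
def TwoForm.IsHolomorphic (σ : TwoForm E X) : Prop :=
  ∀ e ∈ IsManifold.maximalAtlas 𝓘(ℂ, E) ω X, ContDiffOn ℂ ω (σ.inChart e) e.target

/-- Holomorphic symplectic forms: holomorphic, closed, and non-degenerate at every point. -/
structure TwoForm.IsHolomorphicSymplectic (σ : TwoForm E X) : Prop where
  holomorphic : σ.IsHolomorphic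
  closed : ∀ e ∈ IsManifold.maximalAtlas 𝓘(ℂ, E) ω X, ∀ y ∈ e.target,
    extDeriv (σ.inChart e) y = 0
  nondegenerate : ∀ (x : X) (v : TangentSpace 𝓘(ℂ, E) x), (∀ w, σ x ![v, w] = 0) → v = 0

/-- Kähler forms: smooth closed real two-forms `κ` which are compatible with the complex structure
and positive, so that `κ(v, i w)` is a Riemannian metric. -/
structure RealTwoForm.IsKahler (κ : RealTwoForm E X) : Prop where
  smooth : ∀ e ∈ IsManifold.maximalAtlas 𝓘(ℂ, E) ω X, ContDiffOn ℝ ∞ (κ.inChart e) e.target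
  closed : ∀ e ∈ IsManifold.maximalAtlas 𝓘(ℂ, E) ω X, ∀ y ∈ e.target,
    extDeriv (κ.inChart e) y = 0
  compatible : ∀ (x : X) (v w : TangentSpace 𝓘(ℂ, E) x),
    κ x ![Complex.I • v, Complex.I • w] = κ x ![v, w]
  positive : ∀ (x : X) (v : TangentSpace 𝓘(ℂ, E) x), v ≠ 0 → 0 < κ x ![v, Complex.I • v]

variable (E X) in
/-- `X` is a compact hyperkähler manifold of complex dimension `2n` and `σ` is its holomorphic
symplectic form: `X` is a simply connected compact (Hausdorff) Kähler manifold and `H⁰(X, Ω²)` is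
spanned by `σ`. -/
structure IsCompactHyperkahler (n : ℕ) (σ : TwoForm E X) : Prop where
  manifold : IsManifold 𝓘(ℂ, E) ω X
  dimension : Module.finrank ℂ E = 2 * n
  hausdorff : T2Space X
  compact : CompactSpace X
  simplyConnected : SimplyConnectedSpace X
  kahler : ∃ κ : RealTwoForm E X, κ.IsKahler
  symplectic : σ.IsHolomorphicSymplectic
  spans : ∀ τ : TwoForm E X, τ.IsHolomorphic → ∃ c : ℂ, ∀ x, τ x = c • σ x

end Forms

/-! ### Submanifolds, analytic subsets and their tangent spaces -/

section Subsets

variable (E : Type*) [NormedAddCommGroup E] [NormedSpace ℂ E]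
  {X : Type*} [TopologicalSpace X] [ChartedSpace E X]

/-- Near `x`, the set `Z` is a complex submanifold of codimension `c`: a holomorphic chart of `X`
around `x` identifies `Z` with a linear subspace of codimension `c`. -/
def IsSubmanifoldAt (Z : Set X) (c : ℕ) (x : X) : Prop :=
  ∃ e ∈ IsManifold.maximalAtlas 𝓘(ℂ, E) ω X, x ∈ e.source ∧
    ∃ S : Submodule ℂ E, Module.finrank ℂ S + c = Module.finrank ℂ E ∧
      ∀ y ∈ e.source, y ∈ Z ↔ e y ∈ S

/-- Smooth closed complex submanifolds (components may have different dimensions). -/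
structure IsSmoothSubmanifold (Z : Set X) : Prop where
  isClosed : IsClosed Z
  smooth : ∀ x ∈ Z, ∃ c, IsSubmanifoldAt E Z c x

/-- Smooth hypersurfaces: closed complex submanifolds of codimension one. -/
structure IsSmoothHypersurface (D : Set X) : Prop where
  isClosed : IsClosed D
  smooth : ∀ x ∈ D, IsSubmanifoldAt E D 1 x

/-- Subvarieties (closed analytic subsets): every point of `X` has an open neighbourhood on which
`Z` is the common zero set of finitely many holomorphic functions. -/
def IsSubvariety (Z : Set X) : Prop :=
  ∀ x : X, ∃ U : Set X, IsOpen U ∧ x ∈ U ∧ ∃ (k : ℕ) (f : Fin k → X → ℂ),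
    (∀ i, ContMDiffOn 𝓘(ℂ, E) 𝓘(ℂ) ω (f i) U) ∧ ∀ y ∈ U, y ∈ Z ↔ ∀ i, f i y = 0

/-- The smooth locus of `Z`. -/
def smoothLocus (Z : Set X) : Set X := {x | x ∈ Z ∧ ∃ c, IsSubmanifoldAt E Z c x}

/-- `Z` is a subvariety all of whose components have codimension `c`. (The smooth locus is dense in
`Z`, and meets every irreducible component in a manifold of the dimension of that component.) -/
structure IsSubvarietyOfCodim (Z : Set X) (c : ℕ) : Prop where
  isSubvariety : IsSubvariety E Z
  codim : ∀ x ∈ smoothLocus E Z, IsSubmanifoldAt E Z c x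

/-- The tangent space of `Z ⊆ X` at `x`, as a subspace of the tangent space of `X`: the vectors
annihilated by the differentials at `x` of all germs of holomorphic functions vanishing on `Z`.
In a chart identifying `Z` with a linear subspace, it is that subspace. -/
def tangentSpaceOf (Z : Set X) (x : X) : Submodule ℂ (TangentSpace 𝓘(ℂ, E) x) where
  carrier := {v | ∀ f : X → ℂ, ContMDiffAt 𝓘(ℂ, E) 𝓘(ℂ) ω f x → (∀ᶠ y in 𝓝 x, y ∈ Z → f y = 0) →
    mfderiv 𝓘(ℂ, E) 𝓘(ℂ) f x v = 0}
  add_mem' := fun {v w} hv hw f hf hZ => by rw [map_add, hv f hf hZ, hw f hf hZ, add_zero]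
  zero_mem' := fun f _ _ => map_zero _
  smul_mem' := fun c v hv f hf hZ => by rw [map_smul, hv f hf hZ, smul_zero]

end Subsets

/-! ### Symplectic linear algebra in the tangent spaces -/

section Linear

variable {W : Type*} [AddCommGroup W] [Module ℂ W] [TopologicalSpace W]

/-- `U^⊥ = {w | s(u, w) = 0 for all u ∈ U}`. -/
def perp (s : W [⋀^Fin 2]→L[ℂ] ℂ) (U : Submodule ℂ W) : Submodule ℂ W where
  carrier := {w | ∀ u ∈ U, s ![u, w] = 0}
  add_mem' := fun {v w} hv hw u hu => by
    have key : ∀ z : W, Function.update ![u, 0] 1 z = ![u, z] := fun z => by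
      ext i; fin_cases i <;> rfl
    have h := s.map_update_add ![u, 0] 1 v w
    rw [key, key, key] at h
    rw [h, hv u hu, hw u hu, add_zero]
  zero_mem' := fun u _ => s.map_coord_zero 1 rfl
  smul_mem' := fun c v hv u hu => by
    have key : ∀ z : W, Function.update ![u, 0] 1 z = ![u, z] := fun z => by
      ext i; fin_cases i <;> rfl
    have h := s.map_update_smul ![u, 0] 1 c v
    rw [key, key] at h
    rw [h, hv u hu, smul_zero]

/-- The kernel of the restriction `s|_U : U → U^*`, as a subspace of `W`. -/
def restrictKer (s : W [⋀^Fin 2]→L[ℂ] ℂ) (U : Submodule ℂ W) : Submodule ℂ W := U ⊓ perp s U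

end Linear

/-! ### The characteristic foliation -/

section Foliation

variable {E : Type*} [NormedAddCommGroup E] [NormedSpace ℂ E]
  {X : Type*} [TopologicalSpace X] [ChartedSpace E X]

/-- Fibre at `x ∈ D` of the characteristic foliation `ker(σ|_D : T_D → Ω_D)`. -/
def charFoliation (σ : TwoForm E X) (D : Set X) (x : X) :
    Submodule ℂ (TangentSpace 𝓘(ℂ, E) x) :=
  restrictKer (σ x) (tangentSpaceOf E D x)

/-- The points of `L`, without the topology induced from `X`. -/
def Carrier (L : Set X) : Type _ := {x : X // x ∈ L}

/-- The inclusion of `L` in `X`. -/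
def Carrier.incl (L : Set X) (p : Carrier L) : X := Subtype.val p

/-- `L ⊆ D` is a connected immersed complex submanifold tangent to the characteristic foliation:
`L` has a topology (in general finer than the induced one) and a complex structure for which it is a
connected complex manifold of dimension one, the inclusion in `X` is a holomorphic immersion, and
the tangent space of `L` at each point is the fibre of the foliation. (The Hausdorff property and
second countability are then automatic.) -/
def IsIntegralManifold (σ : TwoForm E X) (D L : Set X) : Prop :=
  L ⊆ D ∧ ∃ (_ : TopologicalSpace (Carrier L)) (_ : ChartedSpace ℂ (Carrier L)),
    IsManifold 𝓘(ℂ) ω (Carrier L) ∧ ConnectedSpace (Carrier L) ∧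
    ContMDiff 𝓘(ℂ) 𝓘(ℂ, E) ω (Carrier.incl L) ∧
    ∀ p : Carrier L, Function.Injective (mfderiv 𝓘(ℂ) 𝓘(ℂ, E) (Carrier.incl L) p) ∧
      LinearMap.range (mfderiv 𝓘(ℂ) 𝓘(ℂ, E) (Carrier.incl L) p).toLinearMap =
        charFoliation σ D (Carrier.incl L p)

/-- Leaves of the characteristic foliation: maximal connected immersed submanifolds tangent
to it. -/
def IsLeaf (σ : TwoForm E X) (D L : Set X) : Prop := Maximal (IsIntegralManifold σ D) L

/-- `Z ⊆ D` is invariant: on the smooth locus of `Z`, the foliation is contained in the tangent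
bundle of `Z`. -/
def IsInvariant (σ : TwoForm E X) (D Z : Set X) : Prop :=
  ∀ x ∈ smoothLocus E Z, charFoliation σ D x ≤ tangentSpaceOf E Z x

/-- Smooth Lagrangian submanifolds: closed submanifolds whose tangent spaces are Lagrangian,
`U = U^⊥`. -/
structure IsLagrangianSubmanifold (σ : TwoForm E X) (T : Set X) : Prop where
  isSmoothSubmanifold : IsSmoothSubmanifold E T
  lagrangian : ∀ x ∈ T, tangentSpaceOf E T x = perp (σ x) (tangentSpaceOf E T x)

/-- `Z` is coisotropic: over the smooth locus of `Z`, the kernel of `σ|_Z : T_Z → Ω_Z` has rank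
`codim(Z ⊆ X)`. -/
def IsCoisotropic (σ : TwoForm E X) (Z : Set X) : Prop :=
  ∀ x ∈ smoothLocus E Z,
    Module.finrank ℂ (restrictKer (σ x) (tangentSpaceOf E Z x)) +
      Module.finrank ℂ (tangentSpaceOf E Z x) = Module.finrank ℂ E

end Foliation

end

end CharFol

/-! Both parts rest on symplectic linear algebra in a single tangent space; the first also needs the
local theory of holomorphic foliations by curves.

The characteristic line of a hyperplane `H` is `H^⊥`, which lies in `H` because a line is isotropic.
If `T ⊆ D` is Lagrangian, then `F ⊆ T_D^⊥ ⊆ T_T^⊥ = T_T`, so the foliation is tangent to `T`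
(`IsLagrangianSubmanifold.charFoliation_le`). If `Z ⊆ D` has codimension two, then `F = T_D^⊥` is a
line in the plane `T_Z^⊥`. Once `F ⊆ T_Z`, every vector of this plane is orthogonal to `F` and to
itself, hence to the whole plane, so `T_Z^⊥ ⊆ T_Z` (`finrank_restrictKer_of_le`).

For the leaves, `F` is spanned locally by the Hamiltonian field of an equation of `D`
(`exists_vectorField`). Solving the differential equation inside a submanifold to which the field is
tangent gives integral curves in it (`exists_isIntegralGerm`), and two integral curves through a
point differ by a reparametrization (`IsIntegralGerm.exists_reparam`). If an integral manifold `L`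
meets `T`, then `L ∩ T` is open in `L`, since integral curves starting on `T` stay there, and
closed, since `T` is closed in `X`. As `L` is connected, `L ⊆ T`.

That `T` is covered also requires a leaf through each point `x`. Fix an integral disc, a plaque,
centred at each point of `D`, and take the smallest set containing `x` that no plaque crosses.
Plaques are its charts and reparametrizations its transition maps. A clopen piece is again
saturated, so minimality gives connectedness; a saturated set contains every integral manifold it
meets, which gives maximality (`Plaques.isLeaf_leaf`). -/

namespace CharFol

/-! ### Holomorphic ordinary differential equations -/

section ComplexODE

variable {E : Type*} [NormedAddCommGroup E] [NormedSpace ℂ E]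

/-- Existence of holomorphic solutions of autonomous holomorphic differential equations, by Picard
iteration on a small disc. -/
theorem exists_hasDerivAt_of_contDiffAt [CompleteSpace E] {V : E → E} {y₀ : E}
    (hV : ContDiffAt ℂ 1 V y₀) :
    ∃ r > 0, ∃ y : ℂ → E, y 0 = y₀ ∧ ∀ z ∈ Metric.ball (0 : ℂ) r, HasDerivAt y (V (y z)) z := by
  obtain ⟨K, t, ht, hK⟩ := hV.exists_lipschitzOnWith
  have hd : ∀ᶠ y in 𝓝 y₀, DifferentiableAt ℂ V y :=
    (hV.eventually (by simp)).mono fun y hy => hy.differentiableAt (by simp)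
  obtain ⟨R, hR, hRt⟩ := Metric.nhds_basis_closedBall.mem_iff.1 (Filter.inter_mem ht hd)
  have hKR : LipschitzOnWith K V (Metric.closedBall y₀ R) := hK.mono fun y hy => (hRt hy).1
  have hdR : ∀ y ∈ Metric.closedBall y₀ R, DifferentiableAt ℂ V y := fun y hy => (hRt hy).2
  set M : ℝ := ‖V y₀‖ + K * R with hM
  have hM0 : 0 ≤ M := by positivity
  have hVM : ∀ y ∈ Metric.closedBall y₀ R, ‖V y‖ ≤ M := fun y hy => by
    have h1 := hKR.dist_le_mul y hy y₀ (Metric.mem_closedBall_self hR.le)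
    have h2 : ‖V y‖ ≤ ‖V y₀‖ + ‖V y - V y₀‖ := by
      simpa using norm_add_le (V y₀) (V y - V y₀)
    rw [dist_eq_norm] at h1
    have h3 : (K : ℝ) * dist y y₀ ≤ K * R :=
      mul_le_mul_of_nonneg_left (Metric.mem_closedBall.1 hy) K.2
    linarith
  -- `r * M ≤ R` keeps the Picard iterates in the ball where `V` is controlled; `r * K ≤ 1 / 2`
  -- makes consecutive iterates approach each other geometrically.
  obtain ⟨r, hr, hrM, hrK⟩ : ∃ r : ℝ, 0 < r ∧ r * M ≤ R ∧ r * K ≤ 1 / 2 := by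
    have hK0 : (0 : ℝ) ≤ K := K.2
    have e1 : ∀ᶠ r : ℝ in 𝓝[>] 0, r * M < R := by
      refine (Continuous.tendsto' (by fun_prop) _ _ ?_ : Tendsto (fun r : ℝ => r * M) (𝓝 0)
        (𝓝 0)).mono_left nhdsWithin_le_nhds |>.eventually_lt_const hR
      simp
    have e2 : ∀ᶠ r : ℝ in 𝓝[>] 0, r * (K : ℝ) < 1 / 2 := by
      refine (Continuous.tendsto' (by fun_prop) _ _ ?_ : Tendsto (fun r : ℝ => r * (K : ℝ)) (𝓝 0)
        (𝓝 0)).mono_left nhdsWithin_le_nhds |>.eventually_lt_const (by norm_num)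
      simp
    obtain ⟨r, h1, h2, h3⟩ := (e1.and (e2.and self_mem_nhdsWithin)).exists
    exact ⟨r, h3, h1.le, h2.le⟩
  have h0 : (0 : ℂ) ∈ Metric.ball (0 : ℂ) r := Metric.mem_ball_self hr
  have hconv : Convex ℝ (Metric.ball (0 : ℂ) r) := convex_ball _ _
  let Good : Type _ := {g : ℂ → E // DifferentiableOn ℂ g (Metric.ball 0 r) ∧ g 0 = y₀ ∧
    ∀ z ∈ Metric.ball (0 : ℂ) r, g z ∈ Metric.closedBall y₀ R}
  have step : ∀ g : Good, ∃ g' : Good, ∀ z ∈ Metric.ball (0 : ℂ) r,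
      HasDerivAt g'.1 (V (g.1 z)) z := by
    rintro ⟨g, hg, hg0, hgR⟩
    have hVg : DifferentiableOn ℂ (fun z => V (g z)) (Metric.ball 0 r) := fun z hz =>
      (hdR _ (hgR z hz)).comp_differentiableWithinAt z (hg z hz)
    -- A holomorphic function on a disc has a primitive, which plays the role of the Picard
    -- integral.
    obtain ⟨g', hg'0, hg'⟩ := hVg.isExactOn_ball.with_val_at 0 y₀
    refine ⟨⟨g', fun z hz => (hg' z hz).differentiableAt.differentiableWithinAt, hg'0, ?_⟩,
      fun z hz => hg' z hz⟩
    intro z hz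
    have := hconv.norm_image_sub_le_of_norm_hasDerivWithin_le (f := g') (C := M)
      (fun w hw => (hg' w hw).hasDerivWithinAt) (fun w hw => hVM _ (hgR w hw)) h0 hz
    rw [hg'0] at this
    rw [Metric.mem_closedBall, dist_eq_norm]
    have hz' : ‖z - 0‖ ≤ r := by simpa using (mem_ball_zero_iff.1 hz).le
    nlinarith
  choose next hnext using step
  let s : ℕ → Good := fun k => Nat.rec ⟨fun _ => y₀, differentiableOn_const _, rfl,
    fun _ _ => Metric.mem_closedBall_self hR.le⟩ (fun _ g => next g) k
  have hs : ∀ k, ∀ z ∈ Metric.ball (0 : ℂ) r, HasDerivAt (s (k + 1)).1 (V ((s k).1 z)) z :=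
    fun k => hnext (s k)
  have hdist : ∀ k, ∀ z ∈ Metric.ball (0 : ℂ) r,
      dist ((s k).1 z) ((s (k + 1)).1 z) ≤ R * (1 / 2) ^ k := by
    intro k
    induction k with
    | zero =>
      intro z hz
      rw [dist_comm, pow_zero, mul_one]
      exact (s 1).2.2.2 z hz
    | succ k ih =>
      intro z hz
      have := hconv.norm_image_sub_le_of_norm_hasDerivWithin_le
        (f := fun z => (s (k + 1)).1 z - (s (k + 2)).1 z) (C := K * (R * (1 / 2) ^ k))
        (fun w hw => ((hs k w hw).sub (hs (k + 1) w hw)).hasDerivWithinAt)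
        (fun w hw => by
          rw [← dist_eq_norm]
          exact (hKR.dist_le_mul _ ((s k).2.2.2 w hw) _ ((s (k + 1)).2.2.2 w hw)).trans
            (mul_le_mul_of_nonneg_left (ih w hw) K.2)) h0 hz
      simp only [(s (k + 1)).2.2.1, (s (k + 2)).2.2.1, sub_self, sub_zero] at this
      rw [dist_eq_norm]
      have hz' : ‖z‖ ≤ r := (mem_ball_zero_iff.1 hz).le
      have hp : 0 ≤ R * (1 / 2 : ℝ) ^ k := by positivity
      calc _ ≤ _ := this
        _ ≤ K * (R * (1 / 2) ^ k) * r := mul_le_mul_of_nonneg_left hz' (by positivity)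
        _ = (r * K) * (R * (1 / 2) ^ k) := by ring
        _ ≤ (1 / 2) * (R * (1 / 2) ^ k) := mul_le_mul_of_nonneg_right hrK hp
        _ = R * (1 / 2) ^ (k + 1) := by ring
  have hlim : ∀ z ∈ Metric.ball (0 : ℂ) r, ∃ w, Tendsto (fun k => (s k).1 z) atTop (𝓝 w) :=
    fun z hz => cauchySeq_tendsto_of_complete
      (cauchySeq_of_le_geometric (1 / 2) R (by norm_num) fun k => hdist k z hz)
  choose! y hy using hlim
  have hunif : TendstoUniformlyOn (fun k => (s k).1) y atTop (Metric.ball 0 r) := by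
    rw [Metric.tendstoUniformlyOn_iff]
    intro ε hε
    have : Tendsto (fun k : ℕ => R * (1 / 2 : ℝ) ^ k / (1 - 1 / 2)) atTop (𝓝 0) := by
      have := ((tendsto_pow_atTop_nhds_zero_of_lt_one (r := (1 / 2 : ℝ)) (by norm_num)
        (by norm_num)).const_mul R).div_const (1 - 1 / 2)
      simpa using this
    filter_upwards [this.eventually_lt_const hε] with k hk z hz
    rw [dist_comm]
    exact (dist_le_of_le_geometric_of_tendsto (1 / 2) R (by norm_num) (fun k => hdist k z hz)
      (hy z hz) k).trans_lt hk
  have hloc := hunif.tendstoLocallyUniformlyOn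
  have hdiff : ∀ᶠ k in atTop, DifferentiableOn ℂ (s k).1 (Metric.ball 0 r) :=
    Eventually.of_forall fun k => (s k).2.1
  -- By Weierstrass, a locally uniform limit of holomorphic functions is holomorphic and the
  -- derivatives converge too, so the equation passes to the limit.
  have hyd := hloc.differentiableOn hdiff Metric.isOpen_ball
  have hderiv := hloc.deriv hdiff Metric.isOpen_ball
  have hyR : ∀ z ∈ Metric.ball (0 : ℂ) r, y z ∈ Metric.closedBall y₀ R := fun z hz =>
    Metric.isClosed_closedBall.mem_of_tendsto (hy z hz)
      (Eventually.of_forall fun k => (s k).2.2.2 z hz)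
  refine ⟨r, hr, y, ?_, fun z hz => ?_⟩
  · refine tendsto_nhds_unique (hy 0 h0) ?_
    simp only [fun k => (s k).2.2.1]
    exact tendsto_const_nhds
  · have h1 : Tendsto (fun k => deriv (s (k + 1)).1 z) atTop (𝓝 (deriv y z)) :=
      (tendsto_add_atTop_iff_nat 1).2 (hderiv.tendsto_at hz)
    have h2 : Tendsto (fun k => V ((s k).1 z)) atTop (𝓝 (V (y z))) :=
      (hdR _ (hyR z hz)).continuousAt.tendsto.comp (hy z hz)
    simp only [fun k => (hs k z hz).deriv] at h1
    rw [← tendsto_nhds_unique h1 h2]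
    exact (hyd.differentiableAt (Metric.isOpen_ball.mem_nhds hz)).hasDerivAt

/-- Uniqueness of solutions of `y' = b(z) W(y)` near a point. -/
theorem eventuallyEq_of_hasDerivAt_smul {W : E → E} {b : ℂ → ℂ} {f g : ℂ → E} {z₀ : ℂ}
    (hW : ContDiffAt ℂ 1 W (f z₀)) (hb : ContinuousAt b z₀) (hfg : f z₀ = g z₀)
    (hf : ∀ᶠ z in 𝓝 z₀, HasDerivAt f (b z • W (f z)) z)
    (hg : ∀ᶠ z in 𝓝 z₀, HasDerivAt g (b z • W (g z)) z) : f =ᶠ[𝓝 z₀] g := by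
  obtain ⟨K, t, ht, hK⟩ := hW.exists_lipschitzOnWith
  have hft : ∀ᶠ z in 𝓝 z₀, f z ∈ t := hf.self_of_nhds.continuousAt ht
  have hgt : ∀ᶠ z in 𝓝 z₀, g z ∈ t := hg.self_of_nhds.continuousAt (hfg ▸ ht)
  set M : ℝ := ‖b z₀‖ + 1 with hM
  have hbM : ∀ᶠ z in 𝓝 z₀, ‖b z‖ < M := hb.norm.eventually_lt_const (by simp [hM])
  have hbd : ∀ᶠ z in 𝓝 z₀, ‖f z - g z‖ < 1 := by
    have : ContinuousAt (fun z => ‖f z - g z‖) z₀ :=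
      (hf.self_of_nhds.continuousAt.sub hg.self_of_nhds.continuousAt).norm
    exact this.eventually_lt_const (by simp [hfg])
  obtain ⟨ρ, hρ, hρt⟩ := Metric.nhds_basis_ball.eventually_iff.1
    ((hf.and hg).and ((hft.and hgt).and (hbM.and hbd)))
  obtain ⟨r, hr, hrρ, hrK⟩ : ∃ r : ℝ, 0 < r ∧ r < ρ ∧ r * (M * K) < 1 / 2 := by
    have e2 : ∀ᶠ r : ℝ in 𝓝[>] 0, r * (M * K) < 1 / 2 := by
      refine (Continuous.tendsto' (by fun_prop) _ _ ?_ : Tendsto (fun r : ℝ => r * (M * K)) (𝓝 0)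
        (𝓝 0)).mono_left nhdsWithin_le_nhds |>.eventually_lt_const (by norm_num)
      simp
    have e1 : ∀ᶠ r : ℝ in 𝓝[>] 0, r < ρ := (eventually_lt_nhds hρ).filter_mono nhdsWithin_le_nhds
    obtain ⟨r, h1, h2, h3⟩ := (e1.and (e2.and self_mem_nhdsWithin)).exists
    exact ⟨r, h3, h1, h2⟩
  have hsub : Metric.ball z₀ r ⊆ Metric.ball z₀ ρ := Metric.ball_subset_ball hrρ.le
  -- The mean value inequality on this small ball halves any bound for `f - g`; the initial bound
  -- `1` comes from continuity.
  have key : ∀ k : ℕ, ∀ z ∈ Metric.ball z₀ r, ‖f z - g z‖ ≤ (1 / 2) ^ k := by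
    intro k
    induction k with
    | zero => intro z hz; simpa using (hρt (hsub hz)).2.2.2.le
    | succ k ih =>
      intro z hz
      have := (convex_ball z₀ r).norm_image_sub_le_of_norm_hasDerivWithin_le
        (f := fun z => f z - g z) (C := M * (K * (1 / 2) ^ k))
        (fun w hw => ((hρt (hsub hw)).1.1.sub (hρt (hsub hw)).1.2).hasDerivWithinAt)
        (fun w hw => by
          obtain ⟨-, ⟨h1, h2⟩, h3, -⟩ := hρt (hsub hw)
          rw [← smul_sub, norm_smul, ← dist_eq_norm (W _)]
          refine mul_le_mul h3.le ((hK.dist_le_mul _ h1 _ h2).trans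
            (mul_le_mul_of_nonneg_left ?_ K.2)) dist_nonneg (by positivity)
          rw [dist_eq_norm]
          exact ih w hw) (Metric.mem_ball_self hr) hz
      simp only [hfg, sub_self, sub_zero] at this
      have hz' : ‖z - z₀‖ ≤ r := (mem_ball_iff_norm.1 hz).le
      calc _ ≤ _ := this
        _ ≤ M * (K * (1 / 2) ^ k) * r := mul_le_mul_of_nonneg_left hz' (by positivity)
        _ = (r * (M * K)) * (1 / 2) ^ k := by ring
        _ ≤ (1 / 2) * (1 / 2) ^ k := mul_le_mul_of_nonneg_right hrK.le (by positivity)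
        _ = (1 / 2) ^ (k + 1) := by ring
  filter_upwards [Metric.ball_mem_nhds z₀ hr] with z hz
  have h0 : ‖f z - g z‖ ≤ 0 := ge_of_tendsto' (tendsto_pow_atTop_nhds_zero_of_lt_one
    (r := (1 / 2 : ℝ)) (by norm_num) (by norm_num)) fun k => key k z hz
  exact sub_eq_zero.1 (norm_le_zero_iff.1 h0)

/-- If the vector field is tangent to a linear subspace, the solutions starting there stay there. -/
theorem exists_hasDerivAt_mem_submodule [FiniteDimensional ℂ E] {V : E → E} {y₀ : E}
    (hV : ContDiffAt ℂ 1 V y₀) (S : Submodule ℂ E) (hy₀ : y₀ ∈ S)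
    (hS : ∀ᶠ y in 𝓝 y₀, y ∈ S → V y ∈ S) :
    ∃ y : ℂ → E, y 0 = y₀ ∧ ∀ᶠ z in 𝓝 (0 : ℂ), y z ∈ S ∧ HasDerivAt y (V (y z)) z := by
  have : CompleteSpace E := FiniteDimensional.complete ℂ E
  obtain ⟨P, hP⟩ := S.exists_isCompl
  -- The equation is solved in `S` for the projected field `π ∘ V`, which agrees with `V` on `S`
  -- near `y₀`.
  let π : E →L[ℂ] S := (S.projectionOnto P hP).toContinuousLinearMap
  have hπ : ∀ s : S, π s = s := fun s => Submodule.projectionOnto_apply_left hP s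
  have hV' : ContDiffAt ℂ 1 (fun s : S => π (V s)) ⟨y₀, hy₀⟩ := by
    have h1 : ContDiffAt ℂ 1 (fun s : S => (s : E)) ⟨y₀, hy₀⟩ := S.subtypeL.contDiff.contDiffAt
    exact π.contDiff.contDiffAt.comp _ (ContDiffAt.comp (g := V) (⟨y₀, hy₀⟩ : S) hV h1)
  obtain ⟨r, hr, y, hy, hyd⟩ := exists_hasDerivAt_of_contDiffAt hV'
  refine ⟨fun z => y z, by simp [hy], ?_⟩
  have hc : ContinuousAt (fun z => (y z : E)) 0 :=
    continuous_subtype_val.continuousAt.comp (hyd 0 (Metric.mem_ball_self hr)).continuousAt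
  have hS' : ∀ᶠ z in 𝓝 (0 : ℂ), (y z : E) ∈ S → V (y z) ∈ S :=
    hc.eventually (by simpa [hy] using hS)
  filter_upwards [hS', Metric.ball_mem_nhds _ hr] with z hz hzr
  refine ⟨(y z).2, ?_⟩
  have h1 := S.subtypeL.hasFDerivAt.comp_hasDerivAt z (hyd z hzr)
  have h2 : ((π (V (y z)) : S) : E) = V (y z) := by
    have := hπ ⟨V (y z), hz (y z).2⟩
    exact congrArg Subtype.val this
  rw [← h2]
  exact h1

end ComplexODE

/-! ### Symplectic linear algebra -/

section SymplecticLinearAlgebra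

variable {W : Type*} [AddCommGroup W] [Module ℂ W] [TopologicalSpace W]

theorem twoForm_swap (s : W [⋀^Fin 2]→L[ℂ] ℂ) (v w : W) : s ![w, v] = -s ![v, w] := by
  have h := s.map_swap ![v, w] (i := 0) (j := 1) (by simp)
  refine Eq.trans (congrArg s ?_) h
  ext i
  fin_cases i <;> rfl

theorem twoForm_self (s : W [⋀^Fin 2]→L[ℂ] ℂ) (v : W) : s ![v, v] = 0 :=
  s.map_eq_zero_of_eq ![v, v] (i := 0) (j := 1) rfl (by simp)

/-- The bilinear form underlying an alternating two-form. -/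
noncomputable def twoFormBilin (s : W [⋀^Fin 2]→L[ℂ] ℂ) : LinearMap.BilinForm ℂ W :=
  LinearMap.mk₂ ℂ (fun v w => s ![v, w])
    (fun v v' w => s.vecCons_add ![w] v v')
    (fun c v w => s.vecCons_smul ![w] c v)
    (fun v w w' => by
      rw [twoForm_swap s (w + w') v, twoForm_swap s w v, twoForm_swap s w' v]
      linear_combination -s.vecCons_add ![v] w w')
    (fun c v w => by
      rw [twoForm_swap s (c • w) v, twoForm_swap s w v]
      have := s.vecCons_smul ![v] c w
      rw [smul_neg]
      exact congrArg Neg.neg this)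

@[simp] theorem twoFormBilin_apply (s : W [⋀^Fin 2]→L[ℂ] ℂ) (v w : W) :
    twoFormBilin s v w = s ![v, w] := rfl

theorem perp_eq_orthogonal (s : W [⋀^Fin 2]→L[ℂ] ℂ) (U : Submodule ℂ W) :
    perp s U = (twoFormBilin s).orthogonal U := rfl

theorem twoFormBilin_isRefl (s : W [⋀^Fin 2]→L[ℂ] ℂ) : (twoFormBilin s).IsRefl := fun v w h => by
  rw [twoFormBilin_apply] at h ⊢
  rw [twoForm_swap, h, neg_zero]

theorem perp_anti (s : W [⋀^Fin 2]→L[ℂ] ℂ) {U U' : Submodule ℂ W} (h : U ≤ U') :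
    perp s U' ≤ perp s U := fun _ hw u hu => hw u (h hu)

variable {s : W [⋀^Fin 2]→L[ℂ] ℂ}

theorem twoFormBilin_nondegenerate (hs : ∀ v, (∀ w, s ![v, w] = 0) → v = 0) :
    (twoFormBilin s).Nondegenerate := by
  refine ⟨fun v hv => hs v hv, fun v hv => hs v fun w => ?_⟩
  rw [twoForm_swap, ← twoFormBilin_apply, hv, neg_zero]

variable [FiniteDimensional ℂ W]

theorem finrank_perp (hs : ∀ v, (∀ w, s ![v, w] = 0) → v = 0) (U : Submodule ℂ W) :
    Module.finrank ℂ (perp s U) + Module.finrank ℂ U = Module.finrank ℂ W := by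
  rw [perp_eq_orthogonal, LinearMap.BilinForm.finrank_orthogonal (twoFormBilin_nondegenerate hs)]
  have := U.finrank_le
  omega

theorem perp_perp (hs : ∀ v, (∀ w, s ![v, w] = 0) → v = 0) (U : Submodule ℂ W) :
    perp s (perp s U) = U :=
  LinearMap.BilinForm.orthogonal_orthogonal (twoFormBilin_nondegenerate hs)
    (twoFormBilin_isRefl s) U

/-- The characteristic line of the hyperplane `ker l` is spanned by the Hamiltonian vector of
`l`. -/
theorem restrictKer_ker (hs : ∀ v, (∀ w, s ![v, w] = 0) → v = 0) (l : W →ₗ[ℂ] ℂ) {v : W}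
    (hv : ∀ w, s ![v, w] = l w) : restrictKer s l.ker = Submodule.span ℂ {v} := by
  have h1 : l.ker = perp s (Submodule.span ℂ {v}) := by
    ext w
    refine ⟨fun hw u hu => ?_, fun hw => ?_⟩
    · obtain ⟨c, rfl⟩ := Submodule.mem_span_singleton.1 hu
      rw [← twoFormBilin_apply, map_smul, LinearMap.smul_apply, twoFormBilin_apply, hv,
        LinearMap.mem_ker.1 hw, smul_zero]
    · rw [LinearMap.mem_ker, ← hv]
      exact hw v (Submodule.mem_span_singleton_self v)
  have h2 : v ∈ l.ker := by rw [LinearMap.mem_ker, ← hv, twoForm_self]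
  rw [restrictKer]
  nth_rewrite 2 [h1]
  rw [perp_perp hs]
  exact inf_eq_right.2 ((Submodule.span_singleton_le_iff_mem _ _).2 h2)

/-- A subspace of codimension two of a hyperplane which contains the characteristic line of the
hyperplane is coisotropic. -/
theorem finrank_restrictKer_of_le (hs : ∀ v, (∀ w, s ![v, w] = 0) → v = 0) {U H : Submodule ℂ W}
    (hUH : U ≤ H) (hU : Module.finrank ℂ U + 2 = Module.finrank ℂ W)
    (hH : Module.finrank ℂ H + 1 = Module.finrank ℂ W) (hle : restrictKer s H ≤ U) :
    Module.finrank ℂ (restrictKer s U) + Module.finrank ℂ U = Module.finrank ℂ W := by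
  have hpH : Module.finrank ℂ (perp s H) = 1 := by have := finrank_perp hs H; omega
  have hpU : Module.finrank ℂ (perp s U) = 2 := by have := finrank_perp hs U; omega
  obtain ⟨⟨f, hf⟩, hf0, hfs⟩ := finrank_eq_one_iff'.1 hpH
  have hf0' : f ≠ 0 := fun h => hf0 (Subtype.ext h)
  -- The line `H^⊥` is spanned by `f`, and `f` is orthogonal to itself, so `f ∈ H^⊥⊥ = H`.
  have hfH : f ∈ H := by
    rw [← perp_perp hs H]
    intro u hu
    obtain ⟨c, hc⟩ := hfs ⟨u, hu⟩
    obtain rfl : c • f = u := congrArg Subtype.val hc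
    rw [← twoFormBilin_apply, map_smul, LinearMap.smul_apply, twoFormBilin_apply, twoForm_self,
      smul_zero]
  have hfU : f ∈ U := hle ⟨hfH, hf⟩
  have hle' : perp s U ≤ U := by
    intro w hw
    by_cases hwf : ∃ a : ℂ, a • f = w
    · obtain ⟨a, rfl⟩ := hwf
      exact U.smul_mem a hfU
    push Not at hwf
    have hli : LinearIndependent ℂ ![f, w] := (LinearIndependent.pair_iff' hf0').2 hwf
    -- If `w` is not on the line of `f`, the two span the plane `U^⊥`. Since `w` is orthogonal to `f
    -- ∈ U` and to itself, it lies in `U^⊥⊥ = U`.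
    have hspan : Submodule.span ℂ (Set.range ![f, w]) = perp s U := by
      refine Submodule.eq_of_le_of_finrank_le (Submodule.span_le.2 ?_) ?_
      · rintro _ ⟨i, rfl⟩
        fin_cases i
        exacts [perp_anti s hUH hf, hw]
      · rw [finrank_span_eq_card hli, hpU]
        simp
    rw [← perp_perp hs U, ← hspan]
    intro u hu
    have : Submodule.span ℂ (Set.range ![f, w]) ≤ ((twoFormBilin s).flip w).ker := by
      rw [Submodule.span_le]
      rintro _ ⟨i, rfl⟩
      fin_cases i
      exacts [hw f hfU, twoForm_self s w]
    exact this hu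
  rw [restrictKer, inf_eq_right.2 hle', finrank_perp hs]

end SymplecticLinearAlgebra

/-! ### Tangent spaces in adapted charts -/

section Tangent

variable {E : Type*} [NormedAddCommGroup E] [NormedSpace ℂ E]
  {X : Type*} [TopologicalSpace X] [ChartedSpace E X]

theorem tangentSpaceOf_mono {Z Z' : Set X} (h : Z ⊆ Z') (x : X) :
    tangentSpaceOf E Z x ≤ tangentSpaceOf E Z' x :=
  fun _ hv f hf hZ => hv f hf (hZ.mono fun _ hy hyZ => hy (h hyZ))

theorem mdifferentiable_of_mem_maximalAtlas {e : OpenPartialHomeomorph X E}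
    (he : e ∈ IsManifold.maximalAtlas 𝓘(ℂ, E) ω X) : e.MDifferentiable 𝓘(ℂ, E) 𝓘(ℂ, E) :=
  ⟨(contMDiffOn_of_mem_maximalAtlas he).mdifferentiableOn (by simp),
    (contMDiffOn_symm_of_mem_maximalAtlas he).mdifferentiableOn (by simp)⟩

theorem mfderiv_chartFrame {e : OpenPartialHomeomorph X E}
    (he : e ∈ IsManifold.maximalAtlas 𝓘(ℂ, E) ω X) {y : E} (hy : y ∈ e.target) (w : E) :
    mfderiv 𝓘(ℂ, E) 𝓘(ℂ, E) e (e.symm y) (chartFrame e y w) = w :=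
  DFunLike.congr_fun ((mdifferentiable_of_mem_maximalAtlas he).comp_symm_deriv hy) w

theorem chartFrame_bijective {e : OpenPartialHomeomorph X E}
    (he : e ∈ IsManifold.maximalAtlas 𝓘(ℂ, E) ω X) {y : E} (hy : y ∈ e.target) :
    Function.Bijective (chartFrame e y) :=
  (mdifferentiable_of_mem_maximalAtlas he).symm.mfderiv_bijective hy

theorem chartFrame_mfderiv {e : OpenPartialHomeomorph X E}
    (he : e ∈ IsManifold.maximalAtlas 𝓘(ℂ, E) ω X) {y : E} (hy : y ∈ e.target)
    (v : TangentSpace 𝓘(ℂ, E) (e.symm y)) :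
    chartFrame e y (mfderiv 𝓘(ℂ, E) 𝓘(ℂ, E) e (e.symm y) v) = v := by
  obtain ⟨w, rfl⟩ := (chartFrame_bijective he hy).2 v
  rw [mfderiv_chartFrame he hy]

/-- In a chart adapted to a submanifold, its tangent space is the corresponding linear subspace. -/
theorem mem_tangentSpaceOf_iff [FiniteDimensional ℂ E] {e : OpenPartialHomeomorph X E}
    (he : e ∈ IsManifold.maximalAtlas 𝓘(ℂ, E) ω X) {Z : Set X} {S : Submodule ℂ E}
    (hS : ∀ y ∈ e.source, y ∈ Z ↔ e y ∈ S) {x : X} (hx : x ∈ e.source) (hxZ : x ∈ Z)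
    (v : TangentSpace 𝓘(ℂ, E) x) :
    v ∈ tangentSpaceOf E Z x ↔ mfderiv 𝓘(ℂ, E) 𝓘(ℂ, E) e x v ∈ S := by
  have hed := mdifferentiable_of_mem_maximalAtlas he
  constructor
  · intro hv
    by_contra hvS
    -- A linear form vanishing on `S` but not on the image of `v` pulls back to a function that
    -- vanishes on `Z` with nonzero derivative along `v`.
    obtain ⟨l, hl, hlS⟩ := Submodule.exists_le_ker_of_notMem hvS
    let L : E →L[ℂ] ℂ := LinearMap.toContinuousLinearMap l
    have hLd : MDifferentiableAt 𝓘(ℂ, E) 𝓘(ℂ) L (e x) := L.differentiableAt.mdifferentiableAt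
    have h := hv (L ∘ e) (L.contDiff.contMDiff.contMDiffAt.comp x
      (contMDiffAt_of_mem_maximalAtlas he hx)) ?_
    · rw [mfderiv_comp x hLd (hed.mdifferentiableAt hx), mfderiv_eq_fderiv, L.fderiv] at h
      exact hl h
    · filter_upwards [e.open_source.mem_nhds hx] with y hy hyZ
      exact hlS ((hS y hy).1 hyZ)
  · intro hv f hf hfZ
    obtain ⟨y, hy, rfl⟩ : ∃ y ∈ e.target, e.symm y = x := ⟨e x, e.map_source hx, e.left_inv hx⟩
    have hfd : MDifferentiableAt 𝓘(ℂ, E) 𝓘(ℂ) f (e.symm y) := hf.mdifferentiableAt (by simp)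
    set w : E := mfderiv 𝓘(ℂ, E) 𝓘(ℂ, E) e (e.symm y) v with hw
    have hvw : v = chartFrame e y w := (chartFrame_mfderiv he hy v).symm
    have hyS : y ∈ S := by simpa [e.right_inv hy] using (hS _ hx).1 hxZ
    have hcomp : MDifferentiableAt 𝓘(ℂ, E) 𝓘(ℂ) (f ∘ e.symm) y :=
      hfd.comp y (hed.mdifferentiableAt_symm hy)
    have hfe : DifferentiableAt ℂ (f ∘ e.symm) y := hcomp.differentiableAt
    have h1 : fderiv ℂ (f ∘ e.symm) y w = mfderiv 𝓘(ℂ, E) 𝓘(ℂ) f (e.symm y) v := by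
      rw [hvw, ← mfderiv_eq_fderiv, mfderiv_comp y hfd (hed.mdifferentiableAt_symm hy)]
      rfl
    rw [← h1]
    -- The line through `y` in direction `w` stays in `S`, so `f` vanishes along it and its
    -- derivative in direction `w` is zero.
    have hline : HasDerivAt (fun t : ℂ => y + t • w) w 0 := by
      simpa using ((hasDerivAt_id (0 : ℂ)).smul_const w).const_add y
    have h2 : HasDerivAt (fun t : ℂ => (f ∘ e.symm) (y + t • w)) (fderiv ℂ (f ∘ e.symm) y w) 0 :=
      HasFDerivAt.comp_hasDerivAt (0 : ℂ) (l := f ∘ e.symm) (by simpa using hfe.hasFDerivAt) hline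
    have hct : Tendsto (fun t : ℂ => y + t • w) (𝓝 0) (𝓝 y) := by
      simpa using hline.continuousAt.tendsto
    have h3 : (fun t : ℂ => (f ∘ e.symm) (y + t • w)) =ᶠ[𝓝 0] fun _ => 0 := by
      filter_upwards [hct (e.open_target.mem_nhds hy),
        hct ((e.continuousAt_symm hy).eventually hfZ)] with t ht1 ht2
      refine ht2 ((hS _ (e.map_target ht1)).2 ?_)
      rw [e.right_inv ht1]
      exact S.add_mem hyS (S.smul_mem t hv)
    exact (h2.congr_of_eventuallyEq h3.symm).unique (hasDerivAt_const 0 0)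

theorem finrank_tangentSpaceOf [FiniteDimensional ℂ E] {Z : Set X} {c : ℕ} {x : X} (hxZ : x ∈ Z)
    (h : IsSubmanifoldAt E Z c x) :
    Module.finrank ℂ (tangentSpaceOf E Z x) + c = Module.finrank ℂ E := by
  obtain ⟨e, he, hx, S, hSc, hS⟩ := h
  let φ : E ≃ₗ[ℂ] E := ((mdifferentiable_of_mem_maximalAtlas he).mfderiv hx).toLinearEquiv
  have hφ : (tangentSpaceOf E Z x : Submodule ℂ E).map (φ : E →ₗ[ℂ] E) = S := by
    ext w
    refine ⟨?_, fun hw => ⟨φ.symm w, ?_, φ.apply_symm_apply w⟩⟩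
    · rintro ⟨v, hv, rfl⟩
      exact (mem_tangentSpaceOf_iff he hS hx hxZ v).1 hv
    · refine (mem_tangentSpaceOf_iff he hS hx hxZ _).2 ?_
      exact (φ.apply_symm_apply w).symm ▸ hw
  have h := φ.finrank_map_eq (tangentSpaceOf E Z x : Submodule ℂ E)
  rw [hφ] at h
  rw [← hSc, h]
  rfl

end Tangent

/-! ### The Hamiltonian vector field of a local equation -/

section VectorField

variable {E : Type*} [NormedAddCommGroup E] [NormedSpace ℂ E] [FiniteDimensional ℂ E]

/-- The map `E → E^*` defined by an alternating two-form. -/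
noncomputable def twoFormDual (s : E [⋀^Fin 2]→L[ℂ] ℂ) : E →L[ℂ] E →L[ℂ] ℂ :=
  LinearMap.toContinuousLinearMap
    ((LinearMap.toContinuousLinearMap (𝕜 := ℂ) (E := E) (F' := ℂ)).toLinearMap ∘ₗ twoFormBilin s)

@[simp] theorem twoFormDual_apply (s : E [⋀^Fin 2]→L[ℂ] ℂ) (v w : E) :
    twoFormDual s v w = s ![v, w] := rfl

theorem contDiff_twoFormDual {m : WithTop ℕ∞} :
    ContDiff ℂ m (twoFormDual : (E [⋀^Fin 2]→L[ℂ] ℂ) → E →L[ℂ] E →L[ℂ] ℂ) := by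
  refine contDiff_clm_apply_iff.2 fun v => contDiff_clm_apply_iff.2 fun w => ?_
  exact (ContinuousAlternatingMap.apply ℂ E ℂ ![v, w]).contDiff

theorem isInvertible_twoFormDual {s : E [⋀^Fin 2]→L[ℂ] ℂ}
    (hs : ∀ v, (∀ w, s ![v, w] = 0) → v = 0) : (twoFormDual s).IsInvertible := by
  have hinj : Function.Injective (twoFormDual s).toLinearMap := by
    refine (injective_iff_map_eq_zero _).2 fun v hv => hs v fun w => ?_
    exact DFunLike.congr_fun (hv : twoFormDual s v = 0) w
  have hdim : Module.finrank ℂ E = Module.finrank ℂ (E →L[ℂ] ℂ) := by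
    rw [← (LinearMap.toContinuousLinearMap (𝕜 := ℂ) (E := E) (F' := ℂ)).finrank_eq]
    exact (Subspace.dual_finrank_eq (K := ℂ) (V := E)).symm
  refine ⟨(LinearEquiv.ofInjectiveOfFinrankEq _ hinj hdim).toContinuousLinearEquiv, ?_⟩
  ext v w
  rfl

variable {X : Type*} [TopologicalSpace X] [ChartedSpace E X] {σ : TwoForm E X} {D : Set X}

omit [FiniteDimensional ℂ E] in
theorem inChart_apply (σ : TwoForm E X) (e : OpenPartialHomeomorph X E) (y v w : E) :
    σ.inChart e y ![v, w] = σ (e.symm y) ![chartFrame e y v, chartFrame e y w] := by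
  refine congrArg (σ (e.symm y)) ?_
  ext i
  fin_cases i <;> rfl

omit [FiniteDimensional ℂ E] in
theorem inChart_nondegenerate (hσ : σ.IsHolomorphicSymplectic) {e : OpenPartialHomeomorph X E}
    (he : e ∈ IsManifold.maximalAtlas 𝓘(ℂ, E) ω X) {y : E} (hy : y ∈ e.target) (v : E)
    (hv : ∀ w, σ.inChart e y ![v, w] = 0) : v = 0 := by
  refine (chartFrame_bijective he hy).1 ?_
  rw [map_zero]
  refine hσ.nondegenerate _ _ fun w => ?_
  obtain ⟨w, rfl⟩ := (chartFrame_bijective he hy).2 w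
  rw [← inChart_apply, hv]

/-- In any chart, the characteristic foliation is spanned near a point of the hypersurface by a
nowhere vanishing holomorphic vector field: the Hamiltonian field of a local equation. -/
theorem exists_vectorField (hσ : σ.IsHolomorphicSymplectic) (hD : IsSmoothHypersurface E D) {p : X}
    (hp : p ∈ D) {e : OpenPartialHomeomorph X E}
    (he : e ∈ IsManifold.maximalAtlas 𝓘(ℂ, E) ω X) (hpe : p ∈ e.source) :
    ∃ V : E → E, ContDiffAt ℂ 1 V (e p) ∧ ∀ᶠ y in 𝓝 (e p), y ∈ e.target ∧ V y ≠ 0 ∧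
      (e.symm y ∈ D → charFoliation σ D (e.symm y) = Submodule.span ℂ {chartFrame e y (V y)}) := by
  obtain ⟨d, hd, hpd, S, hSc, hS⟩ := hD.smooth p hp
  have hSlt : S < ⊤ := by
    refine lt_top_iff_ne_top.2 fun h => ?_
    rw [h, finrank_top] at hSc
    omega
  obtain ⟨l, hl0, hSl⟩ := Submodule.exists_le_ker_of_lt_top S hSlt
  have hSl' : S = l.ker := by
    refine Submodule.eq_of_le_of_finrank_le hSl ?_
    have h1 := l.finrank_range_add_finrank_ker
    rw [LinearMap.range_eq_top.2 (LinearMap.surjective hl0), finrank_top,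
      Module.finrank_self] at h1
    omega
  let L : E →L[ℂ] ℂ := LinearMap.toContinuousLinearMap l
  have hed := mdifferentiable_of_mem_maximalAtlas he
  have hdd := mdifferentiable_of_mem_maximalAtlas hd
  have hmem : ∀ᶠ y in 𝓝 (e p), y ∈ e.target ∧ e.symm y ∈ d.source := by
    refine (e.open_target.eventually_mem (e.map_source hpe)).and ?_
    refine (e.continuousAt_symm (e.map_source hpe)).eventually ?_
    rw [e.left_inv hpe]
    exact d.open_source.mem_nhds hpd
  set g : E → ℂ := fun y => L (d (e.symm y)) with hg
  have hgd : ∀ y, y ∈ e.target → e.symm y ∈ d.source → ContDiffAt ℂ ω g y := by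
    intro y hy hyd
    refine L.contDiff.contDiffAt.comp y (ContMDiffAt.contDiffAt ?_)
    exact (contMDiffAt_of_mem_maximalAtlas hd hyd).comp y (contMDiffAt_symm_of_mem_maximalAtlas he hy)
  have hfd : ∀ y, y ∈ e.target → e.symm y ∈ d.source → ∀ w, fderiv ℂ g y w =
      L (mfderiv 𝓘(ℂ, E) 𝓘(ℂ, E) d (e.symm y) (chartFrame e y w)) := by
    intro y hy hyd w
    have h1 : MDifferentiableAt 𝓘(ℂ, E) 𝓘(ℂ, E) (d ∘ e.symm) y :=
      (hdd.mdifferentiableAt hyd).comp y (hed.mdifferentiableAt_symm hy)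
    have h2 : fderiv ℂ g y = L.comp (fderiv ℂ (d ∘ e.symm) y) :=
      (L.hasFDerivAt.comp y h1.differentiableAt.hasFDerivAt).fderiv
    rw [h2, ← mfderiv_eq_fderiv,
      mfderiv_comp y (hdd.mdifferentiableAt hyd) (hed.mdifferentiableAt_symm hy)]
    rfl
  have hσe := hσ.holomorphic e he
  -- `g` is the local equation of `D` read in `e`, and this field solves `σ(V, ·) = dg`.
  refine ⟨fun y => (twoFormDual (σ.inChart e y)).inverse (fderiv ℂ g y), ?_, ?_⟩
  · have : CompleteSpace E := FiniteDimensional.complete ℂ E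
    have hinv := isInvertible_twoFormDual (inChart_nondegenerate hσ he (e.map_source hpe))
    have h1 : ContDiffAt ℂ 1 (fun y => (twoFormDual (σ.inChart e y)).inverse) (e p) :=
      ContDiffAt.comp (e p) (hinv.contDiffAt_map_inverse)
        (contDiff_twoFormDual.contDiffAt.comp (e p)
          ((hσe.contDiffAt (e.open_target.mem_nhds (e.map_source hpe))).of_le (by simp)))
    exact h1.clm_apply ((hgd (e p) (e.map_source hpe)
      (by rwa [e.left_inv hpe])).fderiv_right (m := 1) (by simp))
  · filter_upwards [hmem] with y ⟨hy, hyd⟩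
    set V := (twoFormDual (σ.inChart e y)).inverse (fderiv ℂ g y) with hV
    have hinv := isInvertible_twoFormDual (inChart_nondegenerate hσ he hy)
    have hVeq : twoFormDual (σ.inChart e y) V = fderiv ℂ g y := hinv.self_apply_inverse _
    have hVw : ∀ w, σ (e.symm y) ![chartFrame e y V, w] =
        L (mfderiv 𝓘(ℂ, E) 𝓘(ℂ, E) d (e.symm y) w) := by
      intro w
      obtain ⟨w, rfl⟩ := (chartFrame_bijective he hy).2 w
      rw [← hfd y hy hyd, ← hVeq, twoFormDual_apply, inChart_apply]
    refine ⟨hy, fun hV0 => ?_, fun hyD => ?_⟩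
    · obtain ⟨u, hu⟩ := LinearMap.surjective hl0 1
      obtain ⟨w, hw⟩ := (hdd.mfderiv_surjective hyd) u
      have := hVw w
      rw [hV0, map_zero, hw] at this
      have h0 : L u = 0 := by
        rw [← this]
        exact (twoFormBilin (σ (e.symm y))).map_zero₂ w
      exact one_ne_zero (hu.symm.trans h0)
    · have hker : tangentSpaceOf E D (e.symm y) =
          LinearMap.ker ((L ∘L (mfderiv 𝓘(ℂ, E) 𝓘(ℂ, E) d (e.symm y))).toLinearMap :
            TangentSpace 𝓘(ℂ, E) (e.symm y) →ₗ[ℂ] ℂ) := by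
        ext v
        rw [mem_tangentSpaceOf_iff hd hS hyd hyD, hSl']
        rfl
      have : FiniteDimensional ℂ (TangentSpace 𝓘(ℂ, E) (e.symm y)) :=
        inferInstanceAs (FiniteDimensional ℂ E)
      rw [charFoliation, hker]
      exact restrictKer_ker (hσ.nondegenerate _) _ hVw

end VectorField

/-! ### Integral curves and their uniqueness -/

section IntegralCurves

theorem exists_analyticAt_inverse {u : ℂ → ℂ} {z₀ : ℂ} (hu : AnalyticAt ℂ u z₀)
    (hu' : deriv u z₀ ≠ 0) : ∃ φ : ℂ → ℂ, AnalyticAt ℂ φ (u z₀) ∧ φ (u z₀) = z₀ ∧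
      (∀ᶠ w in 𝓝 (u z₀), u (φ w) = w) ∧ ∀ᶠ z in 𝓝 z₀, φ (u z) = z := by
  have hl := hu.hasStrictDerivAt.eventually_left_inverse hu'
  exact ⟨_, hu.analyticAt_localInverse hu', hl.self_of_nhds,
    hu.hasStrictDerivAt.eventually_right_inverse hu', hl⟩

variable {E : Type*} [NormedAddCommGroup E] [NormedSpace ℂ E]
  {X : Type*} [TopologicalSpace X] [ChartedSpace E X] {σ : TwoForm E X} {D : Set X}

/-- Near `z₀`, the map `c` is a holomorphic immersion in `D` tangent to the characteristic
foliation. -/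
def IsIntegralGerm (σ : TwoForm E X) (D : Set X) (c : ℂ → X) (z₀ : ℂ) : Prop :=
  ∀ᶠ z in 𝓝 z₀, ContMDiffAt 𝓘(ℂ) 𝓘(ℂ, E) ω c z ∧ c z ∈ D ∧
    (mfderiv 𝓘(ℂ) 𝓘(ℂ, E) c z (1 : ℂ) : TangentSpace 𝓘(ℂ, E) (c z)) ≠ 0 ∧
    mfderiv 𝓘(ℂ) 𝓘(ℂ, E) c z (1 : ℂ) ∈ charFoliation σ D (c z)

theorem IsIntegralGerm.eventually {c : ℂ → X} {z₀ : ℂ} (h : IsIntegralGerm σ D c z₀) :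
    ∀ᶠ z in 𝓝 z₀, IsIntegralGerm σ D c z :=
  eventually_eventually_nhds.2 h

theorem IsIntegralGerm.contMDiffAt {c : ℂ → X} {z₀ : ℂ} (h : IsIntegralGerm σ D c z₀) :
    ContMDiffAt 𝓘(ℂ) 𝓘(ℂ, E) ω c z₀ :=
  h.self_of_nhds.1

theorem IsIntegralGerm.mem {c : ℂ → X} {z₀ : ℂ} (h : IsIntegralGerm σ D c z₀) : c z₀ ∈ D :=
  h.self_of_nhds.2.1

theorem mem_charFoliation_iff {e : OpenPartialHomeomorph X E}
    (he : e ∈ IsManifold.maximalAtlas 𝓘(ℂ, E) ω X) {x : X} (hx : x ∈ e.source) {u : E}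
    (h : charFoliation σ D (e.symm (e x)) = Submodule.span ℂ {chartFrame e (e x) u})
    (v : TangentSpace 𝓘(ℂ, E) x) :
    v ∈ charFoliation σ D x ↔ ∃ a : ℂ, a • u = mfderiv 𝓘(ℂ, E) 𝓘(ℂ, E) e x v := by
  obtain ⟨y, hy, rfl⟩ : ∃ y ∈ e.target, e.symm y = x := ⟨e x, e.map_source hx, e.left_inv hx⟩
  rw [e.right_inv hy] at h
  rw [h, Submodule.mem_span_singleton]
  refine exists_congr fun a => ?_
  rw [← map_smul]
  refine ⟨fun hv => ?_, fun hv => ?_⟩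
  · rw [← hv, mfderiv_chartFrame he hy]
  · rw [hv, chartFrame_mfderiv he hy]

theorem charFoliation_eq_span {e : OpenPartialHomeomorph X E} {x : X} (hx : x ∈ e.source) {u : E}
    (h : charFoliation σ D (e.symm (e x)) = Submodule.span ℂ {chartFrame e (e x) u})
    {v : TangentSpace 𝓘(ℂ, E) x} (hv : v ∈ charFoliation σ D x) (hv0 : v ≠ 0) :
    charFoliation σ D x = Submodule.span ℂ {v} := by
  obtain ⟨y, hy, rfl⟩ : ∃ y ∈ e.target, e.symm y = x := ⟨e x, e.map_source hx, e.left_inv hx⟩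
  rw [e.right_inv hy] at h
  rw [h] at hv ⊢
  obtain ⟨a, rfl⟩ := Submodule.mem_span_singleton.1 hv
  have ha : a ≠ 0 := fun ha => hv0 (by rw [ha, zero_smul])
  exact (Submodule.span_singleton_smul_eq ha.isUnit _).symm

theorem hasDerivAt_comp_mfderiv {e : OpenPartialHomeomorph X E}
    (he : e ∈ IsManifold.maximalAtlas 𝓘(ℂ, E) ω X) {c : ℂ → X} {z : ℂ}
    (hc : MDifferentiableAt 𝓘(ℂ) 𝓘(ℂ, E) c z) (hz : c z ∈ e.source) :
    HasDerivAt (fun z => e (c z)) (mfderiv 𝓘(ℂ, E) 𝓘(ℂ, E) e (c z)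
      (mfderiv 𝓘(ℂ) 𝓘(ℂ, E) c z (1 : ℂ))) z := by
  have hed := (mdifferentiable_of_mem_maximalAtlas he).mdifferentiableAt hz
  have h1 : DifferentiableAt ℂ (e ∘ c) z := (hed.comp z hc).differentiableAt
  have h2 := h1.hasFDerivAt.hasDerivAt
  rw [← mfderiv_eq_fderiv, mfderiv_comp z hed hc] at h2
  exact h2

variable [FiniteDimensional ℂ E]

/-- In a chart around `p`, parametrized by a suitable linear coordinate `m`, all integral curves of
the foliation satisfy the same differential equation. -/
theorem exists_normalized_equation (hσ : σ.IsHolomorphicSymplectic)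
    (hD : IsSmoothHypersurface E D) {p : X} (hp : p ∈ D) {e : OpenPartialHomeomorph X E}
    (he : e ∈ IsManifold.maximalAtlas 𝓘(ℂ, E) ω X) (hpe : p ∈ e.source) :
    ∃ (m : E →L[ℂ] ℂ) (W : E → E), ContDiffAt ℂ 1 W (e p) ∧
      ∀ (c : ℂ → X) (z₀ : ℂ), IsIntegralGerm σ D c z₀ → c z₀ = p → ∀ᶠ z in 𝓝 z₀,
        c z ∈ e.source ∧ AnalyticAt ℂ (fun z => e (c z)) z ∧ deriv (fun z => m (e (c z))) z ≠ 0 ∧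
        HasDerivAt (fun z => e (c z)) (deriv (fun z => m (e (c z))) z • W (e (c z))) z := by
  have : CompleteSpace E := FiniteDimensional.complete ℂ E
  obtain ⟨V, hV, hVe⟩ := exists_vectorField hσ hD hp he hpe
  obtain ⟨m, hm⟩ := SeparatingDual.exists_eq_one (R := ℂ) hVe.self_of_nhds.2.1
  have hmV : ContDiffAt ℂ 1 (fun y => m (V y)) (e p) := m.contDiff.contDiffAt.comp _ hV
  -- The field is rescaled to have `m`-component `1`. The unknown speed of an integral curve is then
  -- the derivative of its `m`-coordinate.
  refine ⟨m, fun y => (m (V y))⁻¹ • V y, (hmV.inv (by simp [hm])).smul hV, ?_⟩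
  rintro c z₀ hc rfl
  have hcc := hc.contMDiffAt.continuousAt
  have hec : ContinuousAt (fun z => e (c z)) z₀ := (e.continuousAt hpe).comp hcc
  have hm0 : ∀ᶠ y in 𝓝 (e (c z₀)), m (V y) ≠ 0 :=
    hmV.continuousAt.eventually_ne (by simp [hm])
  filter_upwards [hc, hcc (e.open_source.mem_nhds hpe), hec.eventually hVe,
    hec.eventually hm0] with z ⟨hzc, hzD, hz0, hzF⟩ hze ⟨_, _, hspan⟩ hzm
  have hD' : e.symm (e (c z)) ∈ D := by rwa [e.left_inv hze]
  obtain ⟨a, ha⟩ := (mem_charFoliation_iff he hze (hspan hD') _).1 hzF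
  have hder := hasDerivAt_comp_mfderiv he (hzc.mdifferentiableAt (by simp)) hze
  rw [← ha] at hder
  have ha0 : a ≠ 0 := by
    rintro rfl
    rw [zero_smul] at ha
    refine hz0 (((mdifferentiable_of_mem_maximalAtlas he).mfderiv_injective hze) ?_)
    rw [map_zero]
    exact ha.symm
  have hmder : deriv (fun z => m (e (c z))) z = a * m (V (e (c z))) := by
    have := (m.hasFDerivAt.comp_hasDerivAt z hder).deriv
    rw [map_smul, smul_eq_mul] at this
    exact this
  refine ⟨hze, ?_, ?_, ?_⟩
  · have h1 : ContMDiffAt 𝓘(ℂ) 𝓘(ℂ, E) ω (e ∘ c) z :=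
      (contMDiffAt_of_mem_maximalAtlas he hze).comp z hzc
    exact h1.contDiffAt.analyticAt
  · rw [hmder]
    exact mul_ne_zero ha0 hzm
  · rw [hmder, smul_smul, mul_assoc, mul_inv_cancel₀ hzm, mul_one]
    exact hder

variable [IsManifold 𝓘(ℂ, E) ω X]

/-- Two integral curves through the same point coincide up to a holomorphic reparametrization. -/
theorem IsIntegralGerm.exists_reparam (hσ : σ.IsHolomorphicSymplectic)
    (hD : IsSmoothHypersurface E D) {c₁ c₂ : ℂ → X} {z₁ z₂ : ℂ} (h₁ : IsIntegralGerm σ D c₁ z₁)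
    (h₂ : IsIntegralGerm σ D c₂ z₂) (h : c₁ z₁ = c₂ z₂) :
    ∃ r : ℂ → ℂ, AnalyticAt ℂ r z₁ ∧ r z₁ = z₂ ∧ ∀ᶠ z in 𝓝 z₁, c₁ z = c₂ (r z) := by
  set e := chartAt E (c₁ z₁)
  have he : e ∈ IsManifold.maximalAtlas 𝓘(ℂ, E) ω X := IsManifold.chart_mem_maximalAtlas _
  have hpe : c₁ z₁ ∈ e.source := mem_chart_source E _
  obtain ⟨m, W, hW, hcurve⟩ := exists_normalized_equation hσ hD h₁.mem he hpe
  have H₁ := hcurve c₁ z₁ h₁ rfl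
  have H₂ := hcurve c₂ z₂ h₂ h.symm
  have hu : ∀ {c : ℂ → X} {z : ℂ}, AnalyticAt ℂ (fun z => e (c z)) z →
      AnalyticAt ℂ (fun z => m (e (c z))) z := fun hc => (m.analyticAt _).comp hc
  obtain ⟨-, ha₁, -, -⟩ := H₁.self_of_nhds
  obtain ⟨-, ha₂, hd₂, -⟩ := H₂.self_of_nhds
  obtain ⟨φ, hφ, hφ₂, hright, -⟩ := exists_analyticAt_inverse (hu ha₂) hd₂
  have hu₁₂ : m (e (c₁ z₁)) = m (e (c₂ z₂)) := by rw [h]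
  have hu₁ : Tendsto (fun z => m (e (c₁ z))) (𝓝 z₁) (𝓝 (m (e (c₂ z₂)))) :=
    hu₁₂ ▸ (hu ha₁).continuousAt.tendsto
  -- As `φ` inverts `m ∘ e ∘ c₂`, this change of parameter gives both curves the same
  -- `m`-coordinate, hence the same normalized equation.
  have hr : AnalyticAt ℂ (fun z => φ (m (e (c₁ z)))) z₁ :=
    AnalyticAt.comp (g := φ) (hu₁₂ ▸ hφ) (hu ha₁)
  have hr₁ : φ (m (e (c₁ z₁))) = z₂ := by rw [hu₁₂, hφ₂]
  have hrt : Tendsto (fun z => φ (m (e (c₁ z)))) (𝓝 z₁) (𝓝 z₂) := by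
    have := hr.continuousAt.tendsto
    rwa [hr₁] at this
  have hmr : ∀ᶠ z in 𝓝 z₁, m (e (c₂ (φ (m (e (c₁ z)))))) = m (e (c₁ z)) := hu₁.eventually hright
  refine ⟨_, hr, hr₁, ?_⟩
  have key : (fun z => e (c₁ z)) =ᶠ[𝓝 z₁] fun z => e (c₂ (φ (m (e (c₁ z))))) := by
    refine eventuallyEq_of_hasDerivAt_smul (b := deriv fun z => m (e (c₁ z))) hW
      (hu ha₁).deriv.continuousAt (by simp only [hφ₂, h]) (H₁.mono fun z hz => hz.2.2.2) ?_
    filter_upwards [hrt.eventually H₂, hr.eventually_analyticAt, hmr.eventually_nhds]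
      with z ⟨_, hz, _, hzd⟩ hrz hmz
    have h1 := hzd.scomp z hrz.differentiableAt.hasDerivAt
    have h2 : HasDerivAt (fun z => m (e (c₂ (φ (m (e (c₁ z)))))))
        (deriv (fun z => m (e (c₂ z))) (φ (m (e (c₁ z)))) *
          deriv (fun z => φ (m (e (c₁ z)))) z) z :=
      HasDerivAt.comp (h₂ := fun z => m (e (c₂ z))) z (hu hz).differentiableAt.hasDerivAt
        hrz.differentiableAt.hasDerivAt
    have h3 := (h2.congr_of_eventuallyEq (EventuallyEq.symm hmz)).deriv
    rw [smul_smul, mul_comm, ← h3] at h1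
    exact h1
  filter_upwards [key, H₁, hrt.eventually H₂] with z hz hz₁ hz₂
  exact e.injOn hz₁.1 hz₂.1 hz

/-- The coordinate `m` along the curve has nonzero derivative, so it already has a local left
inverse. -/
theorem IsIntegralGerm.exists_injOn (hσ : σ.IsHolomorphicSymplectic)
    (hD : IsSmoothHypersurface E D) {c : ℂ → X} {z₀ : ℂ} (h : IsIntegralGerm σ D c z₀) :
    ∃ s ∈ 𝓝 z₀, InjOn c s := by
  set e := chartAt E (c z₀)
  have he : e ∈ IsManifold.maximalAtlas 𝓘(ℂ, E) ω X := IsManifold.chart_mem_maximalAtlas _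
  obtain ⟨m, W, -, hcurve⟩ := exists_normalized_equation hσ hD h.mem he (mem_chart_source E _)
  obtain ⟨-, ha, hd, -⟩ := (hcurve c z₀ h rfl).self_of_nhds
  obtain ⟨φ, -, -, -, hleft⟩ := exists_analyticAt_inverse ((m.analyticAt _).comp ha) hd
  refine ⟨_, hleft, fun z hz z' hz' hzz' => ?_⟩
  rw [← hz, ← hz']
  exact congrArg (fun x => φ (m (e x))) hzz'

omit [IsManifold 𝓘(ℂ, E) ω X] in
/-- Through every point of a submanifold of `D` tangent to the foliation there is an integral curve
in this submanifold. -/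
theorem exists_isIntegralGerm (hσ : σ.IsHolomorphicSymplectic) (hD : IsSmoothHypersurface E D)
    {Z : Set X} (hZD : Z ⊆ D) {p : X} (hp : p ∈ Z) {k : ℕ} (hZ : IsSubmanifoldAt E Z k p)
    (hF : ∀ x ∈ Z, charFoliation σ D x ≤ tangentSpaceOf E Z x) :
    ∃ c : ℂ → X, IsIntegralGerm σ D c 0 ∧ c 0 = p ∧ ∀ᶠ z in 𝓝 (0 : ℂ), c z ∈ Z := by
  have : CompleteSpace E := FiniteDimensional.complete ℂ E
  obtain ⟨e, he, hpe, S, -, hS⟩ := hZ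
  obtain ⟨V, hV, hVe⟩ := exists_vectorField hσ hD (hZD hp) he hpe
  have hed := mdifferentiable_of_mem_maximalAtlas he
  have hZ' : ∀ y ∈ e.target, e.symm y ∈ Z ↔ y ∈ S := fun y hy => by
    rw [hS _ (e.map_target hy), e.right_inv hy]
  have hVS : ∀ᶠ y in 𝓝 (e p), y ∈ S → V y ∈ S := by
    filter_upwards [hVe] with y ⟨hy, _, hspan⟩ hyS
    have hyZ := (hZ' y hy).2 hyS
    have h1 := hF _ hyZ (hspan (hZD hyZ) ▸ Submodule.mem_span_singleton_self _)
    rw [mem_tangentSpaceOf_iff he hS (e.map_target hy) hyZ, mfderiv_chartFrame he hy] at h1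
    exact h1
  obtain ⟨y, hy0, hy⟩ := exists_hasDerivAt_mem_submodule hV S ((hS p hpe).1 hp) hVS
  have hyc : Tendsto y (𝓝 0) (𝓝 (e p)) := hy0 ▸ hy.self_of_nhds.2.continuousAt.tendsto
  have hyV := hyc.eventually hVe
  refine ⟨fun z => e.symm (y z), ?_, by simp only [hy0, e.left_inv hpe], ?_⟩
  · filter_upwards [hy.eventually_nhds, hyV] with z hz ⟨hzt, hzV, hspan⟩
    have hyD : e.symm (y z) ∈ D := hZD ((hZ' _ hzt).2 hz.self_of_nhds.1)
    have hyan : AnalyticAt ℂ y z :=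
      Complex.analyticAt_iff_eventually_differentiableAt.2 (hz.mono fun w hw => hw.2.differentiableAt)
    have hder : mfderiv 𝓘(ℂ) 𝓘(ℂ, E) (fun z => e.symm (y z)) z (1 : ℂ) =
        chartFrame e (y z) (V (y z)) := by
      have h1 := mfderiv_comp (I := 𝓘(ℂ)) (I' := 𝓘(ℂ, E)) (I'' := 𝓘(ℂ, E)) (f := y) (g := e.symm) z
        (hed.mdifferentiableAt_symm hzt) hyan.differentiableAt.mdifferentiableAt
      have h2 : mfderiv 𝓘(ℂ) 𝓘(ℂ, E) y z (1 : ℂ) = V (y z) := by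
        rw [mfderiv_eq_fderiv]
        exact hz.self_of_nhds.2.deriv
      refine (DFunLike.congr_fun h1 (1 : ℂ)).trans ?_
      exact congrArg (chartFrame e (y z)) h2
    refine ⟨(contMDiffAt_symm_of_mem_maximalAtlas he hzt).comp z hyan.contDiffAt.contMDiffAt,
      hyD, ?_, ?_⟩
    · rw [hder]
      intro h0
      exact hzV ((chartFrame_bijective he hzt).1 (h0.trans (map_zero _).symm))
    · rw [hder, hspan hyD]
      exact Submodule.mem_span_singleton_self _
  · filter_upwards [hy, hyV] with z hz hzt
    exact (hZ' _ hzt.1).2 hz.1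

theorem IsIntegralGerm.charFoliation_eq (hσ : σ.IsHolomorphicSymplectic)
    (hD : IsSmoothHypersurface E D) {c : ℂ → X} {z₀ : ℂ} (h : IsIntegralGerm σ D c z₀) :
    charFoliation σ D (c z₀) = Submodule.span ℂ {mfderiv 𝓘(ℂ) 𝓘(ℂ, E) c z₀ (1 : ℂ)} := by
  have he : chartAt E (c z₀) ∈ IsManifold.maximalAtlas 𝓘(ℂ, E) ω X :=
    IsManifold.chart_mem_maximalAtlas _
  have hpe := mem_chart_source E (c z₀)
  obtain ⟨V, -, hVe⟩ := exists_vectorField hσ hD h.mem he hpe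
  obtain ⟨-, -, h0, hF⟩ := h.self_of_nhds
  exact charFoliation_eq_span hpe
    (hVe.self_of_nhds.2.2 (by rw [OpenPartialHomeomorph.left_inv _ hpe]; exact h.mem)) hF h0

end IntegralCurves

/-! ### Riemann surfaces built from discs -/

/-- A family of injectively parametrized discs in a set `M`, one centred at each point, which
overlap along holomorphic changes of parameter. -/
structure DiscAtlas (M : Type*) where
  param : M → ℂ → M
  radius : M → ℝ
  radius_pos : ∀ p, 0 < radius p
  param_zero : ∀ p, param p 0 = p
  injOn : ∀ p, InjOn (param p) (Metric.ball 0 (radius p))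
  reparam : ∀ p q, ∀ s ∈ Metric.ball (0 : ℂ) (radius p), ∀ t ∈ Metric.ball (0 : ℂ) (radius q),
    param p s = param q t →
      ∃ r : ℂ → ℂ, AnalyticAt ℂ r s ∧ r s = t ∧ ∀ᶠ z in 𝓝 s, param p z = param q (r z)

namespace DiscAtlas

variable {M : Type*} (A : DiscAtlas M)

/-- The set `M`, with the structure of a Riemann surface defined by the atlas `A`. -/
def Space (_ : DiscAtlas M) : Type _ := M

theorem zero_mem_ball (p : M) : (0 : ℂ) ∈ Metric.ball (0 : ℂ) (A.radius p) :=
  Metric.mem_ball_self (A.radius_pos p)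

instance : TopologicalSpace A.Space where
  IsOpen U := ∀ p ∈ U, ∀ᶠ z in 𝓝 (0 : ℂ), A.param p z ∈ U
  isOpen_univ := fun _ _ => Eventually.of_forall fun _ => mem_univ _
  isOpen_inter := fun _ _ hU hV p hp => (hU p hp.1).and (hV p hp.2)
  isOpen_sUnion := fun _ h p ⟨U, hU, hp⟩ => (h U hU p hp).mono fun _ hz => ⟨U, hU, hz⟩

theorem isOpen_iff {U : Set A.Space} :
    IsOpen U ↔ ∀ p ∈ U, ∀ᶠ z in 𝓝 (0 : ℂ), A.param p z ∈ U :=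
  Iff.rfl

/-- The parametrization of the disc centred at `p`. -/
def disc (p : A.Space) : ℂ → A.Space := A.param p

/-- Openness is tested only at centres of discs; near a parameter `s`, the disc at `p` is a
reparametrization of the disc centred at the point `A.param p s`. -/
theorem continuousOn_disc (p : A.Space) :
    ContinuousOn (A.disc p) (Metric.ball 0 (A.radius p)) := by
  refine continuousOn_of_forall_continuousAt fun s hs => ?_
  intro N hN
  obtain ⟨U, hUN, hU, hsU⟩ := mem_nhds_iff.1 hN
  obtain ⟨r, hr, hr0, hrs⟩ := A.reparam p (A.param p s) s hs 0 (A.zero_mem_ball _)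
    (A.param_zero _).symm
  have h1 := hr.continuousAt.tendsto
  rw [hr0] at h1
  rw [mem_map]
  filter_upwards [h1.eventually (A.isOpen_iff.1 hU _ hsU), hrs] with z hz hz'
  have h2 : A.disc p z = A.disc (A.disc p s) (r z) := hz'
  have h3 : A.disc (A.disc p s) (r z) ∈ U := hz
  exact hUN (h2 ▸ h3)

theorem isOpen_image_disc (p : A.Space) {W : Set ℂ} (hW : IsOpen W)
    (hWp : W ⊆ Metric.ball 0 (A.radius p)) : IsOpen (A.disc p '' W) := by
  rw [isOpen_iff]
  rintro _ ⟨s, hs, rfl⟩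
  obtain ⟨r, hr, hr0, hrs⟩ := A.reparam (A.param p s) p 0 (A.zero_mem_ball _) s (hWp hs)
    (A.param_zero _)
  have h1 := hr.continuousAt.tendsto
  rw [hr0] at h1
  filter_upwards [h1.eventually (hW.mem_nhds hs), hrs] with z hz hz'
  exact ⟨r z, hz, hz'.symm⟩

/-- The chart at `p`, the inverse of the parametrization of the disc at `p`. -/
noncomputable def chart (p : A.Space) : OpenPartialHomeomorph A.Space ℂ :=
  (OpenPartialHomeomorph.ofContinuousOpenRestrict
    ((A.injOn p).bijOn_image.toPartialEquiv (A.disc p) _ _) (A.continuousOn_disc p)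
    (fun W hW => by
      have h := A.isOpen_image_disc p (Metric.isOpen_ball.isOpenMap_subtype_val W hW)
        (by rintro _ ⟨z, -, rfl⟩; exact z.2)
      exact (congrArg IsOpen (image_image (A.disc p) Subtype.val W)).mp h) Metric.isOpen_ball).symm

theorem chart_symm (p : A.Space) : ⇑(A.chart p).symm = A.disc p := rfl

theorem mem_chart_source (p : A.Space) : p ∈ (A.chart p).source :=
  ⟨0, A.zero_mem_ball p, A.param_zero p⟩

noncomputable instance : ChartedSpace ℂ A.Space where
  atlas := range A.chart
  chartAt := A.chart
  mem_chart_source := A.mem_chart_source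
  chart_mem_atlas := fun p => ⟨p, rfl⟩

/-- Each transition map agrees locally with an analytic change of parameter given by `reparam`. -/
instance : IsManifold 𝓘(ℂ) ω A.Space := by
  refine isManifold_of_contDiffOn _ _ _ ?_
  rintro _ _ ⟨p, rfl⟩ ⟨q, rfl⟩
  intro s hs
  refine ContDiffAt.contDiffWithinAt ?_
  have hs' : s ∈ ((A.chart p).symm ≫ₕ A.chart q).source := hs.1
  have hs1 : s ∈ Metric.ball (0 : ℂ) (A.radius p) := hs'.1
  obtain ⟨t, ht, hst⟩ : ∃ t ∈ Metric.ball (0 : ℂ) (A.radius q), A.disc q t = A.disc p s := hs'.2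
  obtain ⟨r, hr, hr0, hrs⟩ := A.reparam p q s hs1 t ht hst.symm
  have h1 := hr.continuousAt.tendsto
  rw [hr0] at h1
  refine hr.contDiffAt.congr_of_eventuallyEq ?_
  filter_upwards [hrs, h1.eventually (Metric.isOpen_ball.mem_nhds ht)] with z hz hrz
  have h2 := (A.chart q).right_inv (show r z ∈ (A.chart q).target from hrz)
  rw [chart_symm, show A.disc q (r z) = A.disc p z from hz.symm] at h2
  exact h2

theorem mem_iff_of_isClopen {U : Set A.Space} (hU : IsClopen U) (p : A.Space) {z : ℂ}
    (hz : z ∈ Metric.ball (0 : ℂ) (A.radius p)) : A.disc p z ∈ U ↔ p ∈ U := by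
  have hpre : IsPreconnected (A.disc p '' Metric.ball 0 (A.radius p)) :=
    (convex_ball (0 : ℂ) (A.radius p)).isPreconnected.image _ (A.continuousOn_disc p)
  have hp : p ∈ A.disc p '' Metric.ball 0 (A.radius p) := A.mem_chart_source p
  have hzp := mem_image_of_mem (A.disc p) hz
  exact ⟨fun h => hpre.subset_isClopen hU ⟨_, hzp, h⟩ hp,
    fun h => hpre.subset_isClopen hU ⟨_, hp, h⟩ hzp⟩

end DiscAtlas

/-! ### Integral manifolds and connectedness -/

section Leaves

variable {E : Type*} [NormedAddCommGroup E] [NormedSpace ℂ E]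
  {X : Type*} [TopologicalSpace X] [ChartedSpace E X] {σ : TwoForm E X} {D : Set X}

/-- An immersed Riemann surface tangent to the foliation is parametrized by integral curves. -/
theorem isIntegralGerm_comp_chart_symm {M : Type*} [TopologicalSpace M] [ChartedSpace ℂ M]
    [IsManifold 𝓘(ℂ) ω M] {ι : M → X} (hι : ContMDiff 𝓘(ℂ) 𝓘(ℂ, E) ω ι) (hιD : ∀ q, ι q ∈ D)
    (hinj : ∀ q, Function.Injective (mfderiv 𝓘(ℂ) 𝓘(ℂ, E) ι q))
    (hF : ∀ q v, mfderiv 𝓘(ℂ) 𝓘(ℂ, E) ι q v ∈ charFoliation σ D (ι q)) (p : M) :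
    IsIntegralGerm σ D (ι ∘ (chartAt ℂ p).symm) (chartAt ℂ p p) := by
  have he : chartAt ℂ p ∈ IsManifold.maximalAtlas 𝓘(ℂ) ω M := IsManifold.chart_mem_maximalAtlas p
  filter_upwards [(chartAt ℂ p).open_target.mem_nhds (mem_chart_target ℂ p)] with z hz
  have hder := mfderiv_comp z (hι.mdifferentiable (by simp) ((chartAt ℂ p).symm z))
    ((mdifferentiable_of_mem_maximalAtlas he).mdifferentiableAt_symm hz)
  have hder1 : mfderiv 𝓘(ℂ) 𝓘(ℂ, E) (ι ∘ (chartAt ℂ p).symm) z (1 : ℂ) =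
      mfderiv 𝓘(ℂ) 𝓘(ℂ, E) ι ((chartAt ℂ p).symm z) (chartFrame (chartAt ℂ p) z (1 : ℂ)) :=
    DFunLike.congr_fun hder (1 : ℂ)
  refine ⟨(hι _).comp z (contMDiffAt_symm_of_mem_maximalAtlas he hz), hιD _, ?_, ?_⟩
  · rw [hder1]
    intro h0
    have h1 := hinj _ (h0.trans (map_zero _).symm)
    exact one_ne_zero ((chartFrame_bijective he hz).1 (h1.trans (map_zero _).symm))
  · rw [hder1]
    exact hF _ _

variable [FiniteDimensional ℂ E] [IsManifold 𝓘(ℂ, E) ω X]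

/-- A map which in a chart is an integral curve is an immersion tangent to the foliation. -/
theorem immersion_of_eventuallyEq_comp (hσ : σ.IsHolomorphicSymplectic)
    (hD : IsSmoothHypersurface E D) {M : Type*} [TopologicalSpace M] [ChartedSpace ℂ M]
    {ι : M → X} {p : M} {χ : OpenPartialHomeomorph M ℂ}
    (hχ : χ ∈ IsManifold.maximalAtlas 𝓘(ℂ) ω M) (hp : p ∈ χ.source) {c : ℂ → X}
    (hc : IsIntegralGerm σ D c (χ p)) (hι : ι =ᶠ[𝓝 p] c ∘ χ) :
    ContMDiffAt 𝓘(ℂ) 𝓘(ℂ, E) ω ι p ∧ Function.Injective (mfderiv 𝓘(ℂ) 𝓘(ℂ, E) ι p) ∧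
      LinearMap.range (mfderiv 𝓘(ℂ) 𝓘(ℂ, E) ι p).toLinearMap = charFoliation σ D (ι p) := by
  have hχd := mdifferentiable_of_mem_maximalAtlas hχ
  have hbij := hχd.mfderiv_bijective hp
  let dχ : ℂ →L[ℂ] ℂ := mfderiv 𝓘(ℂ) 𝓘(ℂ) χ p
  let w : E := mfderiv 𝓘(ℂ) 𝓘(ℂ, E) c (χ p) (1 : ℂ)
  have hw : w ≠ 0 := hc.self_of_nhds.2.2.1
  -- Every tangent space is `E` by definition; dropping the base point from the type lets the fibre
  -- be transported along `ι p = c (χ p)`.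
  let F : X → Submodule ℂ E := fun x => charFoliation σ D x
  have hF : F (ι p) = Submodule.span ℂ {w} :=
    (congrArg F hι.self_of_nhds).trans (hc.charFoliation_eq hσ hD)
  have hder : ∀ v : ℂ, (mfderiv 𝓘(ℂ) 𝓘(ℂ, E) ι p v : E) = dχ v • w := by
    intro v
    have h1 : (mfderiv 𝓘(ℂ) 𝓘(ℂ, E) ι p : ℂ →L[ℂ] E) =
        (mfderiv 𝓘(ℂ) 𝓘(ℂ, E) c (χ p) : ℂ →L[ℂ] E).comp dχ :=
      hι.mfderiv_eq.trans (mfderiv_comp p (hc.contMDiffAt.mdifferentiableAt (by simp))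
        (hχd.mdifferentiableAt hp))
    have h2 : (mfderiv 𝓘(ℂ) 𝓘(ℂ, E) c (χ p) : ℂ →L[ℂ] E) (dχ v • (1 : ℂ)) = dχ v • w :=
      map_smul _ _ _
    rw [smul_eq_mul, mul_one] at h2
    exact (DFunLike.congr_fun h1 v).trans h2
  refine ⟨(hc.contMDiffAt.comp p (contMDiffAt_of_mem_maximalAtlas hχ hp)).congr_of_eventuallyEq hι,
    fun v v' h => ?_, ?_⟩
  · have h1 : dχ v • w = dχ v' • w := (hder v).symm.trans (h.trans (hder v'))
    exact hbij.1 (smul_left_injective ℂ hw h1)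
  · refine Eq.trans ?_ hF.symm
    ext u
    refine Iff.trans ?_ (Submodule.mem_span_singleton (R := ℂ) (M := E) (x := u) (y := w)).symm
    constructor
    · rintro ⟨v, rfl⟩
      exact ⟨dχ v, (hder v).symm⟩
    · rintro ⟨a, rfl⟩
      obtain ⟨v, hv⟩ := hbij.2 a
      exact ⟨v, (hder v).trans (congrArg (· • w) hv)⟩

/-- A connected integral manifold is contained in `A` if it meets `A` and no integral curve
crosses the boundary of `A`. -/
theorem IsIntegralManifold.subset_of_forall_germ (hσ : σ.IsHolomorphicSymplectic)
    (hD : IsSmoothHypersurface E D) {L A : Set X} (hL : IsIntegralManifold σ D L)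
    (hne : (L ∩ A).Nonempty)
    (hA : ∀ p ∈ L, p ∈ A → ∃ c z₀, IsIntegralGerm σ D c z₀ ∧ c z₀ = p ∧ ∀ᶠ z in 𝓝 z₀, c z ∈ A)
    (hA' : ∀ p ∈ L, p ∉ A → ∃ c z₀, IsIntegralGerm σ D c z₀ ∧ c z₀ = p ∧
      ∀ᶠ z in 𝓝 z₀, c z ∉ A) : L ⊆ A := by
  obtain ⟨hLD, _, _, _, _, hι, hder⟩ := hL
  -- By uniqueness of integral curves, one germ through `p` lying in `B` forces a neighbourhood of
  -- `p` in `L` into `B`. Applied to `A` and `Aᶜ`, this makes the trace of `A` clopen.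
  have hloc : ∀ (B : Set X) (p : Carrier L), (∃ c z₀, IsIntegralGerm σ D c z₀ ∧
      c z₀ = Carrier.incl L p ∧ ∀ᶠ z in 𝓝 z₀, c z ∈ B) → ∀ᶠ q in 𝓝 p, Carrier.incl L q ∈ B := by
    rintro B p ⟨c, z₀, hc, hcp, hcB⟩
    have hg := isIntegralGerm_comp_chart_symm hι (fun q => hLD q.2) (fun q => (hder q).1)
      (fun q v => (hder q).2 ▸ LinearMap.mem_range_self _ v) p
    obtain ⟨r, hr, hr0, hrc⟩ := hg.exists_reparam hσ hD hc (by
      rw [Function.comp_apply, OpenPartialHomeomorph.left_inv _ (mem_chart_source ℂ p), hcp])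
    have h1 := hr.continuousAt.tendsto
    rw [hr0] at h1
    have h2 := (chartAt ℂ p).continuousAt (mem_chart_source ℂ p)
    filter_upwards [h2.eventually hrc, h2.eventually (h1.eventually hcB),
      (chartAt ℂ p).open_source.mem_nhds (mem_chart_source ℂ p)] with q hq1 hq2 hq3
    rw [Function.comp_apply, OpenPartialHomeomorph.left_inv _ hq3] at hq1
    rw [hq1]
    exact hq2
  have hclopen : IsClopen (Carrier.incl L ⁻¹' A) := by
    refine ⟨⟨isOpen_iff_mem_nhds.2 fun p hp => ?_⟩, isOpen_iff_mem_nhds.2 fun p hp => ?_⟩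
    · exact hloc Aᶜ p (hA' _ p.2 hp)
    · exact hloc A p (hA _ p.2 hp)
  obtain ⟨p, hpL, hpA⟩ := hne
  have huniv := hclopen.eq_univ ⟨⟨p, hpL⟩, hpA⟩
  intro q hq
  exact (huniv ▸ mem_univ (⟨q, hq⟩ : Carrier L) : (⟨q, hq⟩ : Carrier L) ∈ Carrier.incl L ⁻¹' A)

/-! ### Plaques and the construction of leaves -/

/-- A choice of an embedded integral disc of the characteristic foliation around each point. -/
structure Plaques (σ : TwoForm E X) (D : Set X) where
  curve : X → ℂ → X
  radius : X → ℝ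
  radius_pos : ∀ p ∈ D, 0 < radius p
  curve_zero : ∀ p ∈ D, curve p 0 = p
  injOn : ∀ p ∈ D, InjOn (curve p) (Metric.ball 0 (radius p))
  isIntegralGerm : ∀ p ∈ D, ∀ z ∈ Metric.ball (0 : ℂ) (radius p), IsIntegralGerm σ D (curve p) z

/-- The foliation is tangent to `D` itself, so integral curves in `D` exist; they are shrunk until
they are injective. -/
theorem nonempty_plaques (hσ : σ.IsHolomorphicSymplectic) (hD : IsSmoothHypersurface E D) :
    Nonempty (Plaques σ D) := by
  have h : ∀ p : X, ∃ (c : ℂ → X) (r : ℝ), p ∈ D → 0 < r ∧ c 0 = p ∧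
      InjOn c (Metric.ball 0 r) ∧ ∀ z ∈ Metric.ball (0 : ℂ) r, IsIntegralGerm σ D c z := by
    intro p
    by_cases hp : p ∈ D
    · obtain ⟨c, hc, hcp, -⟩ := exists_isIntegralGerm hσ hD Subset.rfl hp (hD.smooth p hp)
        fun x _ => inf_le_left
      obtain ⟨s, hs, hinj⟩ := hc.exists_injOn hσ hD
      obtain ⟨r, hr, hrs⟩ := Metric.mem_nhds_iff.1 (inter_mem hs hc.eventually)
      exact ⟨c, r, fun _ => ⟨hr, hcp, hinj.mono fun z hz => (hrs hz).1, fun z hz => (hrs hz).2⟩⟩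
    · exact ⟨fun _ => p, 0, fun h => absurd h hp⟩
  choose c r h using h
  exact ⟨⟨c, r, fun p hp => (h p hp).1, fun p hp => (h p hp).2.1, fun p hp => (h p hp).2.2.1,
    fun p hp => (h p hp).2.2.2⟩⟩

namespace Plaques

variable (P : Plaques σ D)

/-- A set is saturated if it contains each plaque whose centre it contains, and no centre of any
other plaque it meets. -/
def IsSaturated (L : Set X) : Prop :=
  ∀ p ∈ D, ∀ z ∈ Metric.ball (0 : ℂ) (P.radius p), P.curve p z ∈ L ↔ p ∈ L

open Classical in
/-- The plaque centred at `p`, as a curve in the saturated set `L`. -/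
noncomputable def param (L : Set X) (p : Carrier L) (z : ℂ) : Carrier L :=
  -- For saturated `L ⊆ D`, the default `p` can occur only outside the disc of the plaque.
  if h : P.curve (Carrier.incl L p) z ∈ L then ⟨P.curve (Carrier.incl L p) z, h⟩ else p

variable {P} {L : Set X}

omit [FiniteDimensional ℂ E] [IsManifold 𝓘(ℂ, E) ω X] in
theorem incl_param (hLD : L ⊆ D) (hL : P.IsSaturated L) (p : Carrier L) {z : ℂ}
    (hz : z ∈ Metric.ball (0 : ℂ) (P.radius (Carrier.incl L p))) :
    Carrier.incl L (P.param L p z) = P.curve (Carrier.incl L p) z := by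
  have h : P.curve (Carrier.incl L p) z ∈ L := (hL _ (hLD p.2) z hz).2 p.2
  exact congrArg (Carrier.incl L) (dif_pos h)

/-- The atlas of a saturated set given by the plaques. -/
noncomputable def discAtlas (hσ : σ.IsHolomorphicSymplectic) (hD : IsSmoothHypersurface E D)
    (hLD : L ⊆ D) (hL : P.IsSaturated L) : DiscAtlas (Carrier L) where
  param := P.param L
  radius p := P.radius (Carrier.incl L p)
  radius_pos p := P.radius_pos _ (hLD p.2)
  param_zero p := Subtype.ext <| by
    have h := incl_param hLD hL p (Metric.mem_ball_self (P.radius_pos _ (hLD p.2)))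
    exact h.trans (P.curve_zero _ (hLD p.2))
  injOn p z hz w hw h := P.injOn _ (hLD p.2) hz hw <|
    (incl_param hLD hL p hz).symm.trans ((congrArg _ h).trans (incl_param hLD hL p hw))
  reparam p q s hs t ht h := by
    obtain ⟨r, hr, hr0, hrs⟩ := (P.isIntegralGerm _ (hLD p.2) s hs).exists_reparam hσ hD
      (P.isIntegralGerm _ (hLD q.2) t ht)
      ((incl_param hLD hL p hs).symm.trans ((congrArg _ h).trans (incl_param hLD hL q ht)))
    refine ⟨r, hr, hr0, ?_⟩
    have h1 := hr.continuousAt.tendsto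
    rw [hr0] at h1
    filter_upwards [hrs, Metric.isOpen_ball.mem_nhds hs,
      h1.eventually (Metric.isOpen_ball.mem_nhds ht)] with z hz hzp hzq
    exact Subtype.ext ((incl_param hLD hL p hzp).trans (hz.trans (incl_param hLD hL q hzq).symm))

/-- Minimal saturated sets are integral manifolds. -/
theorem isIntegralManifold (hσ : σ.IsHolomorphicSymplectic) (hD : IsSmoothHypersurface E D)
    (hLD : L ⊆ D) (hne : L.Nonempty) (hL : P.IsSaturated L)
    (hmin : ∀ U ⊆ L, U.Nonempty → P.IsSaturated U → L ⊆ U) : IsIntegralManifold σ D L := by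
  let A := discAtlas hσ hD hLD hL
  let ι : A.Space → X := Carrier.incl L
  have hιL : ∀ q, ι q ∈ L := fun q => q.2
  have hιinj : Function.Injective ι := fun q q' h => Subtype.ext h
  have hdisc : ∀ p : A.Space, ∀ z ∈ Metric.ball (0 : ℂ) (P.radius (ι p)),
      ι (A.disc p z) = P.curve (ι p) z := fun p z hz => incl_param hLD hL p hz
  have himm := fun p : A.Space => immersion_of_eventuallyEq_comp hσ hD (ι := ι)
    (IsManifold.chart_mem_maximalAtlas p) (A.mem_chart_source p)
    (P.isIntegralGerm (ι p) (hLD p.2) _ ((A.chart p).map_source (A.mem_chart_source p))) (by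
      filter_upwards [(A.chart p).open_source.mem_nhds (A.mem_chart_source p)] with q hq
      exact (congrArg ι ((A.chart p).left_inv hq)).symm.trans
        (hdisc p _ ((A.chart p).map_source hq)))
  have hconn : PreconnectedSpace A.Space := by
    refine preconnectedSpace_iff_clopen.2 fun U hU => ?_
    rcases U.eq_empty_or_nonempty with hU0 | hU0
    · exact Or.inl hU0
    refine Or.inr (eq_univ_of_forall fun q => ?_)
    have hUL : ι '' U ⊆ L := by
      rintro _ ⟨q, -, rfl⟩
      exact hιL q
    -- Plaques are connected, so a clopen part of `L` is saturated, and by minimality it is all of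
    -- `L`.
    refine (hιinj.mem_set_image).1 (hmin (ι '' U) hUL (hU0.image _) ?_ (hιL q))
    intro p hp z hz
    by_cases hpL : p ∈ L
    · obtain ⟨p, rfl⟩ : ∃ p' : A.Space, ι p' = p := ⟨⟨p, hpL⟩, rfl⟩
      rw [← hdisc p z hz, hιinj.mem_set_image, hιinj.mem_set_image]
      exact A.mem_iff_of_isClopen hU p hz
    · exact ⟨fun h => absurd ((hL p hp z hz).1 (hUL h)) hpL, fun h => absurd (hUL h) hpL⟩
  have hconn' : ConnectedSpace A.Space :=
    { toPreconnectedSpace := hconn, toNonempty := ⟨⟨hne.some, hne.some_mem⟩⟩ }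
  have hsmooth : ContMDiff 𝓘(ℂ) 𝓘(ℂ, E) ω ι := fun p => (himm p).1
  exact ⟨hLD, (inferInstance : TopologicalSpace A.Space),
    (inferInstance : ChartedSpace ℂ A.Space), (inferInstance : IsManifold 𝓘(ℂ) ω A.Space),
    hconn', hsmooth, fun p => (himm p).2⟩

/-- The plaque at a point of `D` lies wholly in `L` or wholly in its complement, and so supplies the
germ needed on either side. -/
theorem _root_.CharFol.IsIntegralManifold.subset_of_isSaturated (hσ : σ.IsHolomorphicSymplectic)
    (hD : IsSmoothHypersurface E D) {L' : Set X} (hL' : IsIntegralManifold σ D L')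
    (hL : P.IsSaturated L) (hne : (L' ∩ L).Nonempty) : L' ⊆ L := by
  have hplaque : ∀ p ∈ D, ∀ᶠ z in 𝓝 (0 : ℂ), P.curve p z ∈ L ↔ p ∈ L := fun p hp => by
    filter_upwards [Metric.ball_mem_nhds _ (P.radius_pos p hp)] with z hz
    exact hL p hp z hz
  have hgerm : ∀ p ∈ D, IsIntegralGerm σ D (P.curve p) 0 := fun p hp =>
    P.isIntegralGerm p hp 0 (Metric.mem_ball_self (P.radius_pos p hp))
  refine hL'.subset_of_forall_germ hσ hD hne (fun p hp hpL => ?_) (fun p hp hpL => ?_)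
  · exact ⟨P.curve p, 0, hgerm p (hL'.1 hp), P.curve_zero p (hL'.1 hp),
      (hplaque p (hL'.1 hp)).mono fun z hz => hz.2 hpL⟩
  · exact ⟨P.curve p, 0, hgerm p (hL'.1 hp), P.curve_zero p (hL'.1 hp),
      (hplaque p (hL'.1 hp)).mono fun z hz h => hpL (hz.1 h)⟩

variable (P) in
/-- The smallest saturated set containing `x`. -/
def leaf (x : X) : Set X := {y | y ∈ D ∧ ∀ U, P.IsSaturated U → x ∈ U → y ∈ U}

omit [FiniteDimensional ℂ E] [IsManifold 𝓘(ℂ, E) ω X] in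
theorem isSaturated_leaf (x : X) : P.IsSaturated (P.leaf x) := fun p hp z hz =>
  ⟨fun h => ⟨hp, fun U hU hx => (hU p hp z hz).1 (h.2 U hU hx)⟩,
    fun h => ⟨(P.isIntegralGerm p hp z hz).mem, fun U hU hx => (hU p hp z hz).2 (h.2 U hU hx)⟩⟩

theorem isLeaf_leaf (hσ : σ.IsHolomorphicSymplectic) (hD : IsSmoothHypersurface E D) {x : X}
    (hx : x ∈ D) : IsLeaf σ D (P.leaf x) := by
  have hxL : x ∈ P.leaf x := ⟨hx, fun U _ hxU => hxU⟩
  refine ⟨isIntegralManifold hσ hD (fun y hy => hy.1) ⟨x, hxL⟩ (isSaturated_leaf x) ?_,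
    fun L' hL' hle => hL'.subset_of_isSaturated hσ hD (isSaturated_leaf x) ⟨x, hle hxL, hxL⟩⟩
  rintro U hU ⟨u, hu⟩ hsat y hy
  by_cases hxU : x ∈ U
  · exact hy.2 U hsat hxU
  -- Complements of saturated sets are saturated: if `x ∉ U`, the smallest saturated set would lie
  -- in `Uᶜ`.
  · exact absurd hu ((hU hu).2 Uᶜ (fun p hp z hz => not_congr (hsat p hp z hz)) hxU)

end Plaques

/-- A leaf which meets a closed submanifold tangent to the foliation is contained in it. -/
theorem IsIntegralManifold.subset_of_isSmoothSubmanifold (hσ : σ.IsHolomorphicSymplectic)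
    (hD : IsSmoothHypersurface E D) {L Z : Set X} (hL : IsIntegralManifold σ D L)
    (hZ : IsSmoothSubmanifold E Z) (hZD : Z ⊆ D)
    (hF : ∀ x ∈ Z, charFoliation σ D x ≤ tangentSpaceOf E Z x) (hne : (L ∩ Z).Nonempty) :
    L ⊆ Z := by
  obtain ⟨P⟩ := nonempty_plaques hσ hD
  refine hL.subset_of_forall_germ hσ hD hne (fun p _ hpZ => ?_) (fun p hp hpZ => ?_)
  · obtain ⟨k, hk⟩ := hZ.smooth p hpZ
    obtain ⟨c, hc⟩ := exists_isIntegralGerm hσ hD hZD hpZ hk hF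
    exact ⟨c, 0, hc⟩
  · have hpD := hL.1 hp
    have hgerm := P.isIntegralGerm p hpD 0 (Metric.mem_ball_self (P.radius_pos p hpD))
    refine ⟨P.curve p, 0, hgerm, P.curve_zero p hpD, ?_⟩
    refine hgerm.contMDiffAt.continuousAt.eventually (hZ.isClosed.isOpen_compl.mem_nhds ?_)
    rwa [P.curve_zero p hpD]

omit [FiniteDimensional ℂ E] [IsManifold 𝓘(ℂ, E) ω X] in
-- Orthogonality reverses inclusions: `T_D^⊥ ⊆ T_T^⊥`, and the latter is `T_T`.
theorem IsLagrangianSubmanifold.charFoliation_le {T : Set X} (hT : IsLagrangianSubmanifold σ T)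
    (hTD : T ⊆ D) {x : X} (hx : x ∈ T) : charFoliation σ D x ≤ tangentSpaceOf E T x := by
  rw [hT.lagrangian x hx]
  exact inf_le_right.trans (perp_anti _ (tangentSpaceOf_mono hTD x))

omit [IsManifold 𝓘(ℂ, E) ω X] in
/-- Invariant subvarieties of codimension two of `X` in `D` are coisotropic. -/
theorem IsInvariant.isCoisotropic (hσ : σ.IsHolomorphicSymplectic)
    (hD : IsSmoothHypersurface E D) {Z : Set X} (hZ : IsSubvarietyOfCodim E Z 2) (hZD : Z ⊆ D)
    (h : IsInvariant σ D Z) : IsCoisotropic σ Z := by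
  intro x hx
  have : FiniteDimensional ℂ (TangentSpace 𝓘(ℂ, E) x) :=
    inferInstanceAs (FiniteDimensional ℂ E)
  exact finrank_restrictKer_of_le (hσ.nondegenerate x) (tangentSpaceOf_mono hZD x)
    (finrank_tangentSpaceOf hx.1 (hZ.codim x hx))
    (finrank_tangentSpaceOf (hZD hx.1) (hD.smooth x (hZD hx.1))) (h x hx)

end Leaves

end CharFol

theorem corollary2p6
    {E : Type*} [NormedAddCommGroup E] [NormedSpace ℂ E] [FiniteDimensional ℂ E]
    {X : Type*} [TopologicalSpace X] [ChartedSpace E X]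
    (n : ℕ) (σ : CharFol.TwoForm E X) (hX : CharFol.IsCompactHyperkahler E X n σ)
    (D : Set X) (hD : CharFol.IsSmoothHypersurface E D) :
    (∀ T : Set X, CharFol.IsLagrangianSubmanifold σ T → T ⊆ D →
      (⋃₀ {L : Set X | CharFol.IsLeaf σ D L ∧ L ⊆ T} = T) ∧
      ∀ L : Set X, CharFol.IsLeaf σ D L → (L ∩ T).Nonempty → L ⊆ T) ∧
    ∀ Z : Set X, CharFol.IsSubvarietyOfCodim E Z 2 → Z ⊆ D → CharFol.IsInvariant σ D Z →
      CharFol.IsCoisotropic σ Z := by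
  have := hX.manifold
  have hσ := hX.symplectic
  refine ⟨fun T hT hTD => ?_, fun Z hZ hZD h => h.isCoisotropic hσ hD hZ hZD⟩
  have hleaf : ∀ L : Set X, CharFol.IsLeaf σ D L → (L ∩ T).Nonempty → L ⊆ T := fun L hL hne =>
    hL.1.subset_of_isSmoothSubmanifold hσ hD hT.isSmoothSubmanifold hTD
      (fun x hx => hT.charFoliation_le hTD hx) hne
  -- The leaf constructed through `x ∈ T` meets `T` at `x`, so it lies in `T`.
  refine ⟨Subset.antisymm (sUnion_subset fun L hL => hL.2) fun x hx => ?_, hleaf⟩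
  obtain ⟨P⟩ := CharFol.nonempty_plaques hσ hD
  have hL := CharFol.Plaques.isLeaf_leaf (P := P) hσ hD (hTD hx)
  have hxL : x ∈ P.leaf x := ⟨hTD hx, fun U _ hxU => hxU⟩
  exact ⟨_, ⟨hL, hleaf _ hL ⟨x, hxL, hx⟩⟩, hxL⟩
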